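/- Let $d\ge 1$ be an integer, $0<s<\min\{1,d/2\}$ and $1\le q<2^*:=\frac{2d}{d-2s}$. For $u\in C_0^\infty(\mathbb{R}^d)$ (complex-valued) put $$h_s[u]=\int_{\mathbb{R}^d}|\xi|^{2s}|\hat u(\xi)|^2\,d\xi-\mathcal C_{s,d}\int_{\mathbb{R}^d}|x|^{-2s}|u(x)|^2\,dx,\qquad \mathcal C_{s,d}=2^{2s}\,\frac{\Gamma((d+2s)/4)^2}{\Gamma((d-2s)/4)^2},$$ where $\hat u(\xi)=(2\pi)^{-d/2}\int_{\mathbb{R}^d}u(x)e^{-i\xi\cdot x}\,dx$. Then there exists a constant $C_{q,d,s}>0$, depending only on $q$, $d$ and $s$, such that for every domain (more generally, every open set) $\Omega\subset\mathbb{R}^d$ of finite Lebesgue measure $|\Omega|$ and every $u\in C_0^\infty(\Omega)$ (smooth, with compact support contained in $\Omega$), $$\|u\|_{L^q}^2\le C_{q,d,s}\,|\Omega|^{2\left(\frac1q-\frac1{2^*}\right)}\,h_s[u].$$ -/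

import Mathlib

open MeasureTheory
open scoped ContDiff FourierTransform

noncomputable section

/-- The unitary Fourier transform
`û(ξ) = (2π)^(-d/2) ∫ u(x) exp(-i ξ·x) dx` on `ℝ^d`. -/
def unitaryFourier {d : ℕ} (u : EuclideanSpace ℝ (Fin d) → ℂ)
    (ξ : EuclideanSpace ℝ (Fin d)) : ℂ :=
  (((2 * Real.pi) ^ (-((d : ℝ) / 2)) : ℝ) : ℂ) *
    ∫ x, u x * Complex.exp (-(Complex.I * ((inner ℝ ξ x : ℝ) : ℂ)))

/-- The sharp constant `2^(2s) Γ((d+2s)/4)² / Γ((d-2s)/4)²` in the fractional Hardy inequality. -/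
def hardyConst (s : ℝ) (d : ℕ) : ℝ :=
  2 ^ (2 * s) * (Real.Gamma (((d : ℝ) + 2 * s) / 4) ^ 2 / Real.Gamma (((d : ℝ) - 2 * s) / 4) ^ 2)

/-- The quadratic form `h_s[u] = ∫ |ξ|^(2s) |û(ξ)|² dξ - C_{s,d} ∫ |x|^(-2s) |u(x)|² dx`.
For `u` smooth with compact support and `0 < s < d/2` both integrands are integrable. -/
def hardyForm {d : ℕ} (s : ℝ) (u : EuclideanSpace ℝ (Fin d) → ℂ) : ℝ :=
  (∫ ξ : EuclideanSpace ℝ (Fin d), ‖ξ‖ ^ (2 * s) * ‖unitaryFourier u ξ‖ ^ 2) -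
    hardyConst s d * ∫ x : EuclideanSpace ℝ (Fin d), ‖x‖ ^ (-(2 * s)) * ‖u x‖ ^ 2

/-- `u ∈ C_0^∞(Ω)`: a smooth complex-valued function (extended by zero to `ℝ^d`) with compact
support contained in `Ω`. -/
structure IsTestFunctionOn {d : ℕ} (Ω : Set (EuclideanSpace ℝ (Fin d)))
    (u : EuclideanSpace ℝ (Fin d) → ℂ) : Prop where
  contDiff : ContDiff ℝ ∞ u
  hasCompactSupport : HasCompactSupport u
  tsupport_subset : tsupport u ⊆ Ω

/-- The Hardy term of `hardyForm` is a convergent integral. -/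
theorem integrable_hardyTerm {d : ℕ} {s : ℝ} (hs : 0 < s) (hd : s < (d:ℝ)/2) {u : EuclideanSpace ℝ (Fin d) → ℂ}
    (hu : IsTestFunctionOn Set.univ u) :
    Integrable fun x : EuclideanSpace ℝ (Fin d) => ‖x‖ ^ (-(2 * s)) * ‖u x‖ ^ 2 := by
  have hdpos : 0 < (d:ℝ) := by linarith
  have hd1 : 0 < d := by exact_mod_cast hdpos
  have : Nonempty (Fin d) := ⟨⟨0, hd1⟩⟩
  obtain ⟨R, hR0, hR⟩ := hu.hasCompactSupport.isCompact.isBounded.subset_ball_lt 0 (0 : EuclideanSpace ℝ (Fin d))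
  have hc := hu.contDiff.continuous
  obtain ⟨M, hM⟩ := hu.hasCompactSupport.exists_bound_of_continuous hc
  have hb : IntegrableOn (fun x : EuclideanSpace ℝ (Fin d) => ‖x‖ ^ (-(2 * s))) (Metric.ball 0 R) := by
    rw [integrableOn_fun_norm_addHaar volume (f := fun r => r ^ (-(2*s)))]
    have h2 : IntegrableOn (fun y : ℝ => y ^ ((d:ℝ) - 1 - 2 * s)) (Set.Ioo 0 R) :=
      (intervalIntegral.integrableOn_Ioo_rpow_iff hR0).2 (by linarith)
    refine h2.congr_fun (fun y hy => ?_) measurableSet_Ioo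
    have hy0 : 0 < y := hy.1
    simp only [finrank_euclideanSpace, Fintype.card_fin, smul_eq_mul]
    rw [← Real.rpow_natCast, ← Real.rpow_add hy0]
    congr 1
    push_cast [Nat.cast_sub hd1]
    ring
  have h3 : IntegrableOn (fun x : EuclideanSpace ℝ (Fin d) => ‖x‖ ^ (-(2 * s)) * ‖u x‖ ^ 2) (Metric.ball 0 R) := by
    refine Integrable.mul_bdd (c := M^2) hb (by fun_prop) (Filter.Eventually.of_forall fun x => ?_)
    rw [norm_pow, norm_norm]
    gcongr
    exact hM x
  refine (integrableOn_iff_integrable_of_support_subset ?_).1 h3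
  intro x hx
  apply hR
  apply subset_tsupport
  intro h
  apply hx
  simp [h]

/-- Comparison with Mathlib's normalization of the Fourier transform. -/
theorem unitaryFourier_eq {d : ℕ} (u : EuclideanSpace ℝ (Fin d) → ℂ) (ξ) :
    unitaryFourier u ξ = (((2 * Real.pi) ^ (-((d : ℝ) / 2)) : ℝ) : ℂ) * 𝓕 u ((2 * Real.pi)⁻¹ • ξ) := by
  rw [unitaryFourier, Real.fourier_eq']
  congr 2
  ext x
  rw [smul_eq_mul, mul_comm]
  congr 2
  rw [inner_smul_right, real_inner_comm]
  push_cast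
  field_simp

/-- The kinetic term of `hardyForm` is a convergent integral. -/
theorem integrable_kineticTerm {d : ℕ} {s : ℝ} (hs : 0 < s) (hs1 : s < 1) {u : EuclideanSpace ℝ (Fin d) → ℂ}
    (hu : IsTestFunctionOn Set.univ u) :
    Integrable fun x : EuclideanSpace ℝ (Fin d) => ‖x‖ ^ (2 * s) * ‖unitaryFourier u x‖ ^ 2 := by
  let f : SchwartzMap (EuclideanSpace ℝ (Fin d)) ℂ := hu.hasCompactSupport.toSchwartzMap hu.contDiff
  have hf : ∀ x, 𝓕 u x = (𝓕 f) x := fun x => by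
    rw [SchwartzMap.fourier_coe]; rfl
  have key : Integrable fun x : EuclideanSpace ℝ (Fin d) => ‖x‖ ^ (2 * s) * ‖𝓕 f x‖ ^ 2 := by
    have hb : ∃ C, ∀ x, (1 + ‖x‖^2) * ‖𝓕 f x‖ ≤ C := by
      obtain ⟨A, hA⟩ := (𝓕 f).decay 0 0
      obtain ⟨B, hB⟩ := (𝓕 f).decay 2 0
      refine ⟨A + B, fun x => ?_⟩
      have := hA.2 x
      have := hB.2 x
      simp only [norm_iteratedFDeriv_zero, pow_zero, one_mul] at *
      linarith
    obtain ⟨C, hC⟩ := hb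
    refine ((𝓕 f).integrable (μ := volume)).norm.const_mul C |>.mono' ?_ (Filter.Eventually.of_forall fun x => ?_)
    · have : Continuous fun x : EuclideanSpace ℝ (Fin d) => ‖x‖ ^ (2 * s) :=
        continuous_norm.rpow_const (fun _ => Or.inr (by positivity))
      exact (this.mul ((SchwartzMap.continuous (𝓕 f)).norm.pow 2)).aestronglyMeasurable
    · rw [Real.norm_of_nonneg (by positivity), pow_two, ← mul_assoc]
      gcongr
      refine le_trans ?_ (hC x)
      gcongr
      rcases le_total ‖x‖ 1 with h | h
      · have := Real.rpow_le_one (norm_nonneg x) h (by positivity : 0 ≤ 2 * s)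
        nlinarith [norm_nonneg x]
      · have := Real.rpow_le_rpow_of_exponent_le h (by linarith : 2 * s ≤ 2)
        rw [Real.rpow_two] at this
        linarith
  have h1 := key.comp_smul (R := (2 * Real.pi)⁻¹) (by positivity)
  refine (h1.const_mul ((2*Real.pi) ^ (2*s) * ((2 * Real.pi) ^ (-((d : ℝ) / 2)))^2)).congr (Filter.Eventually.of_forall fun x => ?_)
  simp only [unitaryFourier_eq, hf, norm_mul, norm_smul, mul_pow]
  rw [Complex.norm_real, Real.norm_of_nonneg (by positivity), Real.norm_of_nonneg (by positivity), Real.mul_rpow (x := (2 * Real.pi)⁻¹) (y := ‖x‖) (by positivity) (by positivity), Real.inv_rpow (by positivity)]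
  have h0 : (2 * Real.pi) ^ (2 * s) ≠ 0 := by positivity
  generalize (2 * Real.pi) ^ (2 * s) = a at h0 ⊢
  field_simp

end

/-!
Write `û` for the Fourier transform of `u`. The inequality follows from an improvement of the
sharp fractional Hardy inequality, of the form `h_s[u] ≥ c μ ∫ |ξ|^(2s-ε) |û|² - K μ^(n+3) ∫ |u|²`
for all `μ > 0`, where `ε (n + 3) = 2s` (`improved_hardy`).

On the Fourier side the weight `|x|^(-2s)` is a positive kernel: it is a superposition of
Gaussians, and a Gaussian multiplier is convolution with a Gaussian. The Schur test with a weight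
`h` therefore bounds the Hardy term by `∫ |û|² (I h) / h`, where `I` is the Riesz potential of
order `2s` (`lintegral_hardyTerm_le_heatPotential`). The power `h = |ξ|^(-(d/2+s))` gives exactly
the sharp constant, because `I` maps powers to powers with explicit Gamma quotients
(`heatPotential_rpow`). These constants are strictly minimal at the exponent `d/2 + s`, by strict
log-convexity of the Beta function (`Gamma_ratio_sq_lt`). Hence the perturbed weight
`|ξ|^(-(d/2+s)) / (1 + μ |ξ|^(-ε))`, whose expansion subtracts `μ |ξ|^(-(d/2+s+ε))`, has a
multiplier below that of the sharp inequality by a multiple of `μ |ξ|^(2s-ε)`, up to a constant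
`K μ^(n+3)` (`trialWeight_heatPotential_le`).

For functions supported in `Ω` the negative term is harmless. The Poincaré inequality of order
`s - ε/2` bounds `∫ |u|²` by a multiple of `|Ω|^((2s-ε)/d) ∫ |ξ|^(2s-ε) |û|²`, and since
`n + 3 > 1` the choice of `μ` as a small multiple of `|Ω|^(-ε/d)` absorbs it
(`exists_remainder_bound`). What remains is the Sobolev inequality of order `s - ε/2` on sets of
finite measure (`sobolev_finite_measure`), for which `q` is still subcritical if `ε` is small.
Because `q` is subcritical, a weak-type inequality suffices, and it follows from splitting `u`
into low and high frequencies level by level (`weak_sobolev`).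
-/

section

open Set Real
open scoped SchwartzMap ComplexConjugate Convolution

/-! ### Gaussian and Gamma integrals, Riesz potentials of powers -/

theorem lintegral_Ioi_comp_mul_left {c : ℝ} (hc : 0 < c) (g : ℝ → ENNReal) :
    ∫⁻ t in Ioi (0 : ℝ), g (c * t) = ENNReal.ofReal c⁻¹ * ∫⁻ v in Ioi (0 : ℝ), g v := by
  have himg : (fun t : ℝ => c * t) '' Ioi 0 = Ioi 0 := by
    rw [Set.image_mul_left_Ioi hc, mul_zero]
  have h := lintegral_image_eq_lintegral_abs_deriv_mul (f := fun t : ℝ => c * t)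
    (f' := fun _ => c) (measurableSet_Ioi (a := (0 : ℝ)))
    (fun x _ => by simpa using ((hasDerivAt_id x).const_mul c).hasDerivWithinAt)
    (fun x _ y _ hxy => mul_left_cancel₀ hc.ne' hxy) g
  rw [himg] at h
  rw [h, abs_of_pos hc, lintegral_const_mul' _ _ ENNReal.ofReal_ne_top, ← mul_assoc,
    ← ENNReal.ofReal_mul (by positivity), inv_mul_cancel₀ hc.ne', ENNReal.ofReal_one, one_mul]

theorem lintegral_rpow_mul_exp_neg_mul {a r : ℝ} (ha : 0 < a) (hr : 0 < r) :
    ∫⁻ t in Ioi (0 : ℝ), ENNReal.ofReal (t ^ (a - 1) * exp (-(r * t))) =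
      ENNReal.ofReal (Gamma a * r ^ (-a)) := by
  rw [← ofReal_integral_eq_lintegral_ofReal]
  · rw [integral_rpow_mul_exp_neg_mul_Ioi ha hr, one_div, inv_rpow hr.le, rpow_neg hr.le, mul_comm]
  · by_contra h
    have h1 := integral_rpow_mul_exp_neg_mul_Ioi ha hr
    rw [integral_undef h] at h1
    have := Gamma_pos_of_pos ha
    have : 0 < (1 / r) ^ a * Gamma a := by positivity
    linarith
  · filter_upwards [ae_restrict_mem measurableSet_Ioi] with t (ht : 0 < t)
    positivity

/-- The Beta integral `∫₀^∞ v^(s-1) (1+v)^(-(s+b)) dv`, by writing the power of `1 + v` as a Gamma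
integral and exchanging the integrals. -/
theorem lintegral_beta_Ioi {s b : ℝ} (hs : 0 < s) (hb : 0 < b) :
    ∫⁻ v in Ioi (0 : ℝ), ENNReal.ofReal (v ^ (s - 1) * (1 + v) ^ (-(s + b))) =
      ENNReal.ofReal (Gamma s * Gamma b / Gamma (s + b)) := by
  have hG := Gamma_pos_of_pos (add_pos hs hb)
  have key : ENNReal.ofReal (Gamma (s + b)) *
      ∫⁻ v in Ioi (0 : ℝ), ENNReal.ofReal (v ^ (s - 1) * (1 + v) ^ (-(s + b))) =
      ENNReal.ofReal (Gamma s * Gamma b) := by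
    calc _ = ∫⁻ v in Ioi (0 : ℝ), ∫⁻ r in Ioi (0 : ℝ),
          ENNReal.ofReal (v ^ (s - 1) * (r ^ (s + b - 1) * exp (-((1 + v) * r)))) := by
          rw [← lintegral_const_mul' _ _ ENNReal.ofReal_ne_top]
          refine setLIntegral_congr_fun measurableSet_Ioi fun v (hv : 0 < v) => ?_
          simp_rw [ENNReal.ofReal_mul (rpow_nonneg hv.le (s - 1))]
          rw [lintegral_const_mul' _ _ ENNReal.ofReal_ne_top,
            lintegral_rpow_mul_exp_neg_mul (by positivity) (by positivity),
            ENNReal.ofReal_mul hG.le]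
          ring
      _ = ∫⁻ r in Ioi (0 : ℝ), ∫⁻ v in Ioi (0 : ℝ),
          ENNReal.ofReal (v ^ (s - 1) * (r ^ (s + b - 1) * exp (-((1 + v) * r)))) :=
          lintegral_lintegral_swap (by fun_prop)
      _ = ∫⁻ r in Ioi (0 : ℝ), ENNReal.ofReal (Gamma s) *
            ENNReal.ofReal (r ^ (b - 1) * exp (-(1 * r))) := by
          refine setLIntegral_congr_fun measurableSet_Ioi fun r (hr : 0 < r) => ?_
          have : ∀ v, ENNReal.ofReal (v ^ (s - 1) * (r ^ (s + b - 1) * exp (-((1 + v) * r)))) =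
              ENNReal.ofReal (r ^ (s + b - 1) * exp (-r)) *
                ENNReal.ofReal (v ^ (s - 1) * exp (-(r * v))) := fun v => by
            rw [← ENNReal.ofReal_mul (by positivity),
              show -((1 + v) * r) = -r + -(r * v) by ring, exp_add]
            congr 1; ring
          simp_rw [this]
          have hGs := (Gamma_pos_of_pos hs).le
          rw [lintegral_const_mul' _ _ ENNReal.ofReal_ne_top,
            lintegral_rpow_mul_exp_neg_mul hs hr, ← ENNReal.ofReal_mul (by positivity),
            ← ENNReal.ofReal_mul hGs]
          congr 1
          rw [show s + b - 1 = (b - 1) + s by ring, rpow_add hr, rpow_neg hr.le]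
          field_simp
      _ = _ := by
          rw [lintegral_const_mul' _ _ ENNReal.ofReal_ne_top,
            lintegral_rpow_mul_exp_neg_mul hb one_pos, one_rpow, mul_one,
            ENNReal.ofReal_mul (Gamma_pos_of_pos hs).le]
  rw [ENNReal.ofReal_div_of_pos hG, ← key, ENNReal.mul_div_right_comm,
    ENNReal.div_self (by simpa using hG) ENNReal.ofReal_ne_top, one_mul]

theorem integral_exp_neg_sq_norm_add {d : ℕ} {b : ℝ} (hb : 0 < b)
    (w : EuclideanSpace ℝ (Fin d)) :
    Integrable (fun η : EuclideanSpace ℝ (Fin d) => exp (-b * ‖η‖ ^ 2 + inner ℝ w η)) ∧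
    ∫ η : EuclideanSpace ℝ (Fin d), exp (-b * ‖η‖ ^ 2 + inner ℝ w η) =
      (π / b) ^ ((d : ℝ) / 2) * exp (‖w‖ ^ 2 / (4 * b)) := by
  have hb' : 0 < (b : ℂ).re := by simpa
  have hi := GaussianFourier.integrable_cexp_neg_mul_sq_norm_add hb' 1 w
  have he : ∀ η : EuclideanSpace ℝ (Fin d),
      Complex.exp (-(b : ℂ) * (‖η‖ : ℂ) ^ 2 + 1 * ((inner ℝ w η : ℝ) : ℂ)) =
      ((exp (-b * ‖η‖ ^ 2 + inner ℝ w η) : ℝ) : ℂ) := fun η => by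
    push_cast; simp
  have h := GaussianFourier.integral_cexp_neg_mul_sq_norm_add hb' 1 w
  simp only [he] at hi h
  refine ⟨by simpa only [RCLike.re_to_complex, Complex.ofReal_re] using hi.re, ?_⟩
  rw [integral_complex_ofReal] at h
  apply Complex.ofReal_injective
  rw [h, Complex.ofReal_mul, Complex.ofReal_cpow (by positivity)]
  simp

/-- The convolution of two Gaussians, by completing the square. -/
theorem lintegral_gaussian_mul_gaussian {d : ℕ} {τ ρ : ℝ} (hτ : 0 < τ) (hρ : 0 < ρ)
    (ξ : EuclideanSpace ℝ (Fin d)) :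
    ∫⁻ η : EuclideanSpace ℝ (Fin d),
        ENNReal.ofReal (exp (-(‖ξ - η‖ ^ 2 / τ)) * exp (-(ρ * ‖η‖ ^ 2))) =
      ENNReal.ofReal ((π * τ) ^ ((d : ℝ) / 2) * (1 + ρ * τ) ^ (-((d : ℝ) / 2)) *
        exp (-(ρ * ‖ξ‖ ^ 2 / (1 + ρ * τ)))) := by
  have hb : 0 < ρ + 1 / τ := by positivity
  obtain ⟨hi, h⟩ := integral_exp_neg_sq_norm_add hb ((2 / τ) • ξ)
  have he : ∀ η : EuclideanSpace ℝ (Fin d), exp (-(‖ξ - η‖ ^ 2 / τ)) * exp (-(ρ * ‖η‖ ^ 2)) =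
      exp (-(‖ξ‖ ^ 2 / τ)) * exp (-(ρ + 1 / τ) * ‖η‖ ^ 2 + inner ℝ ((2 / τ) • ξ) η) := fun η => by
    rw [← exp_add, ← exp_add, norm_sub_sq_real, real_inner_smul_left]
    congr 1
    field_simp
    ring
  simp only [he]
  rw [← ofReal_integral_eq_lintegral_ofReal (hi.const_mul _)
    (Filter.Eventually.of_forall fun η => by positivity), integral_const_mul, h]
  congr 1
  have h1 : π / (ρ + 1 / τ) = (π * τ) * (1 + ρ * τ)⁻¹ := by
    field_simp
    ring
  rw [h1, mul_rpow (by positivity) (by positivity), inv_rpow (by positivity),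
    rpow_neg (by positivity), norm_smul, mul_left_comm, ← exp_add]
  congr 2
  rw [Real.norm_of_nonneg (by positivity)]
  field_simp
  ring

/-- Up to a constant, the Riesz potential `(-Δ)^(-s) h`, written through the heat semigroup
`∫ τ^(s-1) e^(τ'Δ) h dτ` with `τ' = τ / 4`. Values are in `[0, ∞]`, so no
integrability is needed. -/
noncomputable def heatPotential {d : ℕ} (s : ℝ) (h : EuclideanSpace ℝ (Fin d) → ENNReal)
    (ξ : EuclideanSpace ℝ (Fin d)) : ENNReal :=
  ∫⁻ τ in Ioi (0 : ℝ), ENNReal.ofReal (τ ^ (s - 1) * (π * τ) ^ (-((d : ℝ) / 2))) *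
    ∫⁻ η, ENNReal.ofReal (exp (-(‖ξ - η‖ ^ 2 / τ))) * h η

/-- The Riesz potential of a power is a power, with an explicit Gamma quotient: the power
`‖η‖^(-a)` is a superposition of Gaussians, the heat semigroup maps Gaussians to Gaussians, and
the substitution `v = ρ τ` separates the two time variables. For `a = d/2 + s` the constant is, up
to normalization, the reciprocal of the sharp Hardy constant. -/
theorem heatPotential_rpow {d : ℕ} (hd : 1 ≤ d) {s a : ℝ} (hs : 0 < s) (ha : 2 * s < a)
    (had : a < d) {ξ : EuclideanSpace ℝ (Fin d)} (hξ : ξ ≠ 0) :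
    heatPotential s (fun η => ENNReal.ofReal (‖η‖ ^ (-a))) ξ =
      ENNReal.ofReal (Gamma s * (Gamma (a / 2 - s) * Gamma ((d - a) / 2) /
        (Gamma (a / 2) * Gamma (s + (d - a) / 2))) * ‖ξ‖ ^ (2 * s - a)) := by
  have : Nonempty (Fin d) := ⟨⟨0, hd⟩⟩
  have hα : 0 < a / 2 := by linarith
  have hΓ := Gamma_pos_of_pos hα
  have hξ' : 0 < ‖ξ‖ := norm_pos_iff.2 hξ
  have hΓ1 := Gamma_pos_of_pos (show 0 < a / 2 - s by linarith)
  have hΓ2 := Gamma_pos_of_pos hs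
  have hΓ3 := Gamma_pos_of_pos (show 0 < (d - a) / 2 by linarith)
  have hΓ4 := Gamma_pos_of_pos (show 0 < s + (d - a) / 2 by linarith)
  have key : ENNReal.ofReal (Gamma (a / 2)) *
      heatPotential s (fun η : EuclideanSpace ℝ (Fin d) => ENNReal.ofReal (‖η‖ ^ (-a))) ξ =
      ENNReal.ofReal (Gamma s * (Gamma (a / 2 - s) * Gamma ((d - a) / 2) /
        Gamma (s + (d - a) / 2)) * ‖ξ‖ ^ (2 * s - a)) := by
    calc _ = ∫⁻ τ in Ioi (0 : ℝ), ∫⁻ ρ in Ioi (0 : ℝ),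
          ENNReal.ofReal (τ ^ (s - 1) * (ρ ^ (a / 2 - 1) * ((1 + ρ * τ) ^ (-((d : ℝ) / 2)) *
            exp (-(ρ * ‖ξ‖ ^ 2 / (1 + ρ * τ)))))) := by
          rw [heatPotential, ← lintegral_const_mul' _ _ ENNReal.ofReal_ne_top]
          refine setLIntegral_congr_fun measurableSet_Ioi fun τ (hτ : 0 < τ) => ?_
          have h1 : ENNReal.ofReal (Gamma (a / 2)) * ∫⁻ η : EuclideanSpace ℝ (Fin d),
              ENNReal.ofReal (exp (-(‖ξ - η‖ ^ 2 / τ))) * ENNReal.ofReal (‖η‖ ^ (-a)) =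
              ∫⁻ η : EuclideanSpace ℝ (Fin d), ∫⁻ ρ in Ioi (0 : ℝ),
                ENNReal.ofReal (exp (-(‖ξ - η‖ ^ 2 / τ))) *
                ENNReal.ofReal (ρ ^ (a / 2 - 1) * exp (-(‖η‖ ^ 2 * ρ))) := by
            rw [← lintegral_const_mul' _ _ ENNReal.ofReal_ne_top]
            refine lintegral_congr_ae ?_
            filter_upwards [compl_mem_ae_iff.2 (measure_singleton (0 : EuclideanSpace ℝ (Fin d)))]
              with η hη
            have hη' : 0 < ‖η‖ := norm_pos_iff.2 hη
            rw [lintegral_const_mul' _ _ ENNReal.ofReal_ne_top,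
              lintegral_rpow_mul_exp_neg_mul hα (by positivity), ENNReal.ofReal_mul hΓ.le,
              ← rpow_natCast ‖η‖, ← rpow_mul hη'.le]
            rw [show ((2 : ℕ) : ℝ) * -(a / 2) = -a by push_cast; ring]
            ring
          rw [mul_left_comm, h1, lintegral_lintegral_swap (by fun_prop),
            ← lintegral_const_mul' _ _ ENNReal.ofReal_ne_top]
          refine setLIntegral_congr_fun measurableSet_Ioi fun ρ (hρ : 0 < ρ) => ?_
          have h2 : ∀ η : EuclideanSpace ℝ (Fin d), ENNReal.ofReal (exp (-(‖ξ - η‖ ^ 2 / τ))) *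
                ENNReal.ofReal (ρ ^ (a / 2 - 1) * exp (-(‖η‖ ^ 2 * ρ))) =
              ENNReal.ofReal (ρ ^ (a / 2 - 1)) * ENNReal.ofReal (exp (-(‖ξ - η‖ ^ 2 / τ)) *
                exp (-(ρ * ‖η‖ ^ 2))) := fun η => by
            rw [← ENNReal.ofReal_mul (by positivity), ← ENNReal.ofReal_mul (by positivity),
              mul_comm ρ]
            congr 1; ring
          simp only [h2]
          rw [lintegral_const_mul' _ _ ENNReal.ofReal_ne_top,
            lintegral_gaussian_mul_gaussian hτ hρ, ← ENNReal.ofReal_mul (by positivity),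
            ← ENNReal.ofReal_mul (by positivity)]
          congr 1
          rw [rpow_neg (by positivity) ((d : ℝ) / 2)]
          field_simp
      _ = ∫⁻ ρ in Ioi (0 : ℝ), ∫⁻ τ in Ioi (0 : ℝ),
          ENNReal.ofReal (τ ^ (s - 1) * (ρ ^ (a / 2 - 1) * ((1 + ρ * τ) ^ (-((d : ℝ) / 2)) *
            exp (-(ρ * ‖ξ‖ ^ 2 / (1 + ρ * τ)))))) :=
          lintegral_lintegral_swap (by fun_prop)
      _ = ∫⁻ ρ in Ioi (0 : ℝ), ∫⁻ v in Ioi (0 : ℝ),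
          ENNReal.ofReal (v ^ (s - 1) * (1 + v) ^ (-((d : ℝ) / 2))) *
            ENNReal.ofReal (ρ ^ (a / 2 - s - 1) * exp (-(‖ξ‖ ^ 2 / (1 + v) * ρ))) := by
          refine setLIntegral_congr_fun measurableSet_Ioi fun ρ (hρ : 0 < ρ) => ?_
          have h3 := lintegral_Ioi_comp_mul_left hρ fun v =>
            ENNReal.ofReal (v ^ (s - 1) * (1 + v) ^ (-((d : ℝ) / 2))) *
            ENNReal.ofReal (ρ ^ (a / 2 - s - 1) * exp (-(‖ξ‖ ^ 2 / (1 + v) * ρ)))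
          have h4 : ENNReal.ofReal ρ * ENNReal.ofReal ρ⁻¹ = 1 := by
            rw [← ENNReal.ofReal_mul hρ.le, mul_inv_cancel₀ hρ.ne', ENNReal.ofReal_one]
          -- the substitution `v = ρ τ`
          rw [← one_mul (lintegral _ fun v => _ * _), ← h4, mul_assoc, ← h3,
            ← lintegral_const_mul' _ _ ENNReal.ofReal_ne_top]
          refine setLIntegral_congr_fun measurableSet_Ioi fun τ (hτ : 0 < τ) => ?_
          rw [← ENNReal.ofReal_mul (by positivity), ← ENNReal.ofReal_mul (by positivity)]
          congr 1
          rw [mul_rpow hρ.le hτ.le, show a / 2 - 1 = 1 + (s - 1) + (a / 2 - s - 1) by ring,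
            rpow_add hρ, rpow_add hρ, rpow_one,
            show ρ * ‖ξ‖ ^ 2 / (1 + ρ * τ) = ‖ξ‖ ^ 2 / (1 + ρ * τ) * ρ by ring]
          ring
      _ = ∫⁻ v in Ioi (0 : ℝ), ∫⁻ ρ in Ioi (0 : ℝ),
          ENNReal.ofReal (v ^ (s - 1) * (1 + v) ^ (-((d : ℝ) / 2))) *
            ENNReal.ofReal (ρ ^ (a / 2 - s - 1) * exp (-(‖ξ‖ ^ 2 / (1 + v) * ρ))) :=
          lintegral_lintegral_swap (by fun_prop)
      _ = ∫⁻ v in Ioi (0 : ℝ), ENNReal.ofReal (Gamma (a / 2 - s) * ‖ξ‖ ^ (2 * s - a)) *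
            ENNReal.ofReal (v ^ (s - 1) * (1 + v) ^ (-(s + (d - a) / 2))) := by
          refine setLIntegral_congr_fun measurableSet_Ioi fun v (hv : 0 < v) => ?_
          rw [lintegral_const_mul' _ _ ENNReal.ofReal_ne_top,
            lintegral_rpow_mul_exp_neg_mul (by linarith) (by positivity),
            ← ENNReal.ofReal_mul (by positivity), ← ENNReal.ofReal_mul (by positivity)]
          congr 1
          rw [div_eq_mul_inv (‖ξ‖ ^ 2), mul_rpow (by positivity) (by positivity),
            ← rpow_natCast, ← rpow_mul hξ'.le, inv_rpow (by positivity), ← rpow_neg (by positivity),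
            show ((2 : ℕ) : ℝ) * -(a / 2 - s) = 2 * s - a by push_cast; ring,
            show -(s + ((d : ℝ) - a) / 2) = -((d : ℝ) / 2) + - -(a / 2 - s) by ring,
            rpow_add (by positivity)]
          ring
      _ = _ := by
          rw [lintegral_const_mul' _ _ ENNReal.ofReal_ne_top,
            lintegral_beta_Ioi hs (by linarith), ← ENNReal.ofReal_mul (by positivity)]
          congr 1; ring
  have h0 : ENNReal.ofReal (Gamma (a / 2)) ≠ 0 := by simpa using hΓ
  refine (ENNReal.mul_right_inj h0 ENNReal.ofReal_ne_top).1 ?_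
  rw [key, ← ENNReal.ofReal_mul hΓ.le]
  congr 1
  field_simp

/-! ### Strict log-convexity of the Beta function -/

/-- Strict log-convexity of the Beta function `b ↦ B(s, b)`, stated for its Gamma quotient. It
says that the constant in `heatPotential_rpow` is strictly larger at `d/2 + s + 2e` than at
`d/2 + s`, which is where the gain over the Hardy inequality comes from. -/
theorem Gamma_ratio_sq_lt {p s e : ℝ} (hs : 0 < s) (he : 0 < e) (hep : e < p) :
    Gamma p * Gamma p / (Gamma (s + p) * Gamma (s + p)) <
      Gamma (p + e) * Gamma (p - e) / (Gamma (s + (p + e)) * Gamma (s + (p - e))) := by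
  have hp : 0 < p := he.trans hep
  set J : ℝ → ℝ := fun b => Gamma s * Gamma b / Gamma (s + b) with hJ
  have hJpos : ∀ b, 0 < b → 0 < J b := fun b hb => by
    have := Gamma_pos_of_pos hb
    have := Gamma_pos_of_pos hs
    have := Gamma_pos_of_pos (add_pos hs hb)
    positivity
  have h1 := hJpos p hp
  have h2 := hJpos (p + e) (by linarith)
  have h3 := hJpos (p - e) (by linarith)
  -- the arithmetic-geometric mean inequality in the integrand, with equality at one point
  have amgm : ∀ l : ℝ, 0 < l → 2 * l * J p < l ^ 2 * J (p + e) + J (p - e) := by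
    intro l hl
    rw [← ENNReal.ofReal_lt_ofReal_iff (by positivity),
      ENNReal.ofReal_mul (p := 2 * l) (by positivity),
      ENNReal.ofReal_add (by positivity) h3.le, ENNReal.ofReal_mul (p := l ^ 2) (by positivity)]
    simp only [hJ]
    rw [← lintegral_beta_Ioi hs hp, ← lintegral_beta_Ioi hs (show 0 < p + e by linarith),
      ← lintegral_beta_Ioi hs (show 0 < p - e by linarith),
      ← lintegral_const_mul' _ _ ENNReal.ofReal_ne_top,
      ← lintegral_const_mul' _ _ ENNReal.ofReal_ne_top,
      ← lintegral_add_left (by fun_prop)]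
    refine lintegral_strict_mono ?_ (by fun_prop) ?_ ?_
    · rw [Ne, Measure.restrict_eq_zero]
      simp
    · rw [lintegral_const_mul' _ _ ENNReal.ofReal_ne_top, lintegral_beta_Ioi hs hp]
      exact ENNReal.mul_ne_top ENNReal.ofReal_ne_top ENNReal.ofReal_ne_top
    · filter_upwards [ae_restrict_mem measurableSet_Ioi,
        ae_restrict_of_ae (compl_mem_ae_iff.2 (measure_singleton (l ^ (1 / e) - 1)))]
        with v (hv : 0 < v) hne
      rw [← ENNReal.ofReal_mul (by positivity), ← ENNReal.ofReal_mul (by positivity),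
        ← ENNReal.ofReal_add (by positivity) (by positivity),
        ENNReal.ofReal_lt_ofReal_iff (by positivity)]
      have hv1 : 0 < 1 + v := by linarith
      rw [show -(s + (p + e)) = -(s + p) + -e by ring, show -(s + (p - e)) = -(s + p) + e by ring,
        rpow_add hv1, rpow_add hv1, rpow_neg hv1.le e]
      have hy : 0 < (1 + v) ^ e := by positivity
      have hyl : (1 + v) ^ e ≠ l := fun h => hne <| by
        rw [Set.mem_singleton_iff, ← h, ← rpow_mul hv1.le, mul_one_div_cancel he.ne', rpow_one]
        ring
      have hw : 0 < v ^ (s - 1) * (1 + v) ^ (-(s + p)) := by positivity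
      generalize (1 + v) ^ e = y at hy hyl
      have hsq : 0 < (l - y) ^ 2 := by
        have := sub_ne_zero.2 hyl.symm
        positivity
      have : 2 * l < l ^ 2 * y⁻¹ + y := by
        have : l ^ 2 * y⁻¹ + y - 2 * l = (l - y) ^ 2 / y := by field_simp; ring
        have : 0 < (l - y) ^ 2 / y := by positivity
        linarith
      calc _ = v ^ (s - 1) * (1 + v) ^ (-(s + p)) * (2 * l) := by ring
        _ < v ^ (s - 1) * (1 + v) ^ (-(s + p)) * (l ^ 2 * y⁻¹ + y) := by gcongr
        _ = _ := by ring
  -- the quadratic form in `l` is positive; evaluate it at its minimum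
  have hlt : J p * J p < J (p + e) * J (p - e) := by
    have := amgm (J p / J (p + e)) (by positivity)
    have h4 : 2 * (J p / J (p + e)) * J p * J (p + e) <
        ((J p / J (p + e)) ^ 2 * J (p + e) + J (p - e)) * J (p + e) := by gcongr
    have h5 : 2 * (J p / J (p + e)) * J p * J (p + e) = 2 * (J p * J p) := by field_simp
    have h6 : ((J p / J (p + e)) ^ 2 * J (p + e) + J (p - e)) * J (p + e) =
        J p * J p + J (p + e) * J (p - e) := by field_simp
    linarith
  have hs2 : 0 < Gamma s * Gamma s := by
    have := Gamma_pos_of_pos hs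
    positivity
  refine lt_of_mul_lt_mul_left (lt_of_le_of_lt (le_of_eq ?_) (hlt.trans_le (le_of_eq ?_))) hs2.le
  · simp only [hJ]; ring
  · simp only [hJ]; ring

/-! ### The Hardy term on the Fourier side -/

theorem fourier_gaussian_inv {d : ℕ} {τ : ℝ} (hτ : 0 < τ) (x : EuclideanSpace ℝ (Fin d)) :
    𝓕 (fun ζ : EuclideanSpace ℝ (Fin d) => ((exp (-(‖ζ‖ ^ 2 / τ)) : ℝ) : ℂ)) x =
      (((π * τ) ^ ((d : ℝ) / 2) * exp (-(π ^ 2 * ‖x‖ ^ 2 * τ)) : ℝ) : ℂ) := by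
  have h := fourier_gaussian_innerProductSpace (V := EuclideanSpace ℝ (Fin d))
    (b := ((τ⁻¹ : ℝ) : ℂ)) (by simpa using hτ) x
  have he : (fun ζ : EuclideanSpace ℝ (Fin d) => ((exp (-(‖ζ‖ ^ 2 / τ)) : ℝ) : ℂ)) =
      fun ζ => Complex.exp (-((τ⁻¹ : ℝ) : ℂ) * (‖ζ‖ : ℂ) ^ 2) := by
    ext ζ
    push_cast
    congr 1
    ring
  rw [he, h, Complex.ofReal_mul, Complex.ofReal_cpow (by positivity)]
  congr 1
  · simp
  · push_cast
    congr 1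
    field_simp

/-- Plancherel for the Gaussian-weighted norm: on the Fourier side, multiplication by a Gaussian
is convolution with a Gaussian. -/
theorem integral_gaussian_mul_sq_eq {d : ℕ} (U : 𝓢(EuclideanSpace ℝ (Fin d), ℂ)) {τ : ℝ}
    (hτ : 0 < τ) :
    (((π * τ) ^ ((d : ℝ) / 2) * ∫ x, exp (-(π ^ 2 * ‖x‖ ^ 2 * τ)) * ‖U x‖ ^ 2 : ℝ) : ℂ) =
      ∫ ξ, conj (𝓕 U ξ) * ∫ η, ((exp (-(‖ξ - η‖ ^ 2 / τ)) : ℝ) : ℂ) * 𝓕 U η := by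
  set g : EuclideanSpace ℝ (Fin d) → ℂ := fun ζ => ((exp (-(‖ζ‖ ^ 2 / τ)) : ℝ) : ℂ) with hg
  have hgi : Integrable g := by
    have h := (integral_exp_neg_sq_norm_add (d := d) (b := τ⁻¹) (by positivity) 0).1
    have h' : Integrable fun η : EuclideanSpace ℝ (Fin d) => exp (-(‖η‖ ^ 2 / τ)) :=
      h.congr (Filter.Eventually.of_forall fun η => by simp [div_eq_inv_mul])
    exact h'.ofReal
  have hfi : Integrable (fun ξ => 𝓕 U ξ) := (𝓕 U).integrable
  set G : EuclideanSpace ℝ (Fin d) → ℂ :=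
    (fun η => 𝓕 U η) ⋆[ContinuousLinearMap.mul ℂ ℂ] g with hG
  have hGi : Integrable G := hfi.integrable_convolution _ hgi
  have hGe : ∀ ξ, G ξ = ∫ η, ((exp (-(‖ξ - η‖ ^ 2 / τ)) : ℝ) : ℂ) * 𝓕 U η := fun ξ => by
    rw [hG, convolution]
    simp only [ContinuousLinearMap.mul_apply', hg]
    congr 1
    ext η
    ring
  have hinv : ∀ x, 𝓕 (fun η => 𝓕 U η) (-x) = U x := fun x => by
    have h : 𝓕⁻ (𝓕 U) x = U x := by rw [FourierTransform.fourierInv_fourier_eq U]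
    rw [← h, SchwartzMap.fourierInv_coe, Real.fourierInv_eq_fourier_neg]
  have hFG : ∀ x, 𝓕⁻ G x =
      (((π * τ) ^ ((d : ℝ) / 2) * exp (-(π ^ 2 * ‖x‖ ^ 2 * τ)) : ℝ) : ℂ) * U x := fun x => by
    rw [Real.fourierInv_eq_fourier_neg, hG, Real.fourier_mul_convolution_eq hfi hgi,
      fourier_gaussian_inv hτ, norm_neg, mul_comm, hinv x]
  have hdual : ∫ ξ, conj (𝓕 U ξ) * G ξ = ∫ x, conj (U x) * 𝓕⁻ G x := by
    have h := VectorFourier.integral_sesq_fourierIntegral_eq_neg_flip (innerSL ℂ)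
      (L := innerₗ (EuclideanSpace ℝ (Fin d))) continuous_fourierChar continuous_inner
      U.integrable hGi (μ := volume) (ν := volume)
    simp only [innerSL_apply_apply, RCLike.inner_apply] at h
    simp only [mul_comm (conj _)]
    have e1 : ∀ x, VectorFourier.fourierIntegral 𝐞 volume
        (-(innerₗ (EuclideanSpace ℝ (Fin d))).flip) G x = 𝓕⁻ G x := fun x => by
      rw [Real.fourierInv_eq, VectorFourier.fourierIntegral]
      simp [real_inner_comm]
    simp only [e1] at h
    exact h
  simp only [← hGe]
  rw [hdual]
  simp only [hFG]
  rw [← integral_const_mul, ← integral_complex_ofReal]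
  congr 1
  ext x
  rw [mul_left_comm (conj (U x)), Complex.conj_mul']
  push_cast
  ring

/-- The Schur test for a symmetric nonnegative kernel with a positive weight `h`. -/
theorem lintegral_lintegral_symm_kernel_le {E : Type*} [MeasurableSpace E] {μ : Measure E}
    [SFinite μ] {k : E → E → ENNReal} (hk : Measurable (Function.uncurry k))
    (hsymm : ∀ x y, k x y = k y x) {f : E → ENNReal} (hf : Measurable f) {h : E → ℝ}
    (hh : Measurable h) (hpos : ∀ᵐ x ∂μ, 0 < h x) :
    ∫⁻ x, f x * ∫⁻ y, k x y * f y ∂μ ∂μ ≤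
      ∫⁻ x, f x ^ 2 * (ENNReal.ofReal (h x))⁻¹ * ∫⁻ y, k x y * ENNReal.ofReal (h y) ∂μ ∂μ := by
  have amgm : ∀ a b : ENNReal, ∀ x y : ℝ, 0 < x → 0 < y → 2 * (a * b) ≤
      a ^ 2 * ((ENNReal.ofReal x)⁻¹ * ENNReal.ofReal y) +
        b ^ 2 * ((ENNReal.ofReal y)⁻¹ * ENNReal.ofReal x) := by
    intro a b x y hx hy
    have hxy : 0 < y / x := by positivity
    have hyx : 0 < x / y := by positivity
    rw [← ENNReal.ofReal_inv_of_pos hx, ← ENNReal.ofReal_inv_of_pos hy,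
      ← ENNReal.ofReal_mul (by positivity), ← ENNReal.ofReal_mul (by positivity),
      inv_mul_eq_div, inv_mul_eq_div]
    rcases eq_or_ne a ⊤ with rfl | ha
    · simp [ENNReal.top_mul, hxy]
    rcases eq_or_ne b ⊤ with rfl | hb
    · simp [ENNReal.top_mul, hyx]
    lift a to NNReal using ha
    lift b to NNReal using hb
    rw [← ENNReal.ofReal_coe_nnreal, ← ENNReal.ofReal_coe_nnreal,
      ← ENNReal.ofReal_pow (by positivity), ← ENNReal.ofReal_pow (by positivity),
      ← ENNReal.ofReal_mul (by positivity), ← ENNReal.ofReal_mul (by positivity),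
      ← ENNReal.ofReal_mul (by positivity), ← ENNReal.ofReal_add (by positivity) (by positivity),
      show (2 : ENNReal) = ENNReal.ofReal 2 by simp, ← ENNReal.ofReal_mul (by positivity)]
    refine ENNReal.ofReal_le_ofReal ?_
    have : (a : ℝ) ^ 2 * (y / x) + (b : ℝ) ^ 2 * (x / y) - 2 * (a * b) =
        (a * y - b * x) ^ 2 / (x * y) := by field_simp; ring
    have : 0 ≤ (a * y - b * x) ^ 2 / (x * y) := by positivity
    linarith
  set S := ∫⁻ x, f x ^ 2 * (ENNReal.ofReal (h x))⁻¹ * ∫⁻ y, k x y * ENNReal.ofReal (h y) ∂μ ∂μ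
    with hS
  have hS1 : S = ∫⁻ x, ∫⁻ y, k x y *
      (f x ^ 2 * ((ENNReal.ofReal (h x))⁻¹ * ENNReal.ofReal (h y))) ∂μ ∂μ := by
    refine lintegral_congr fun x => ?_
    have hkx : Measurable (k x) := hk.comp measurable_prodMk_left
    rw [← lintegral_const_mul _ (by fun_prop)]
    refine lintegral_congr fun y => ?_
    ring
  have hS2 : S = ∫⁻ x, ∫⁻ y, k x y *
      (f y ^ 2 * ((ENNReal.ofReal (h y))⁻¹ * ENNReal.ofReal (h x))) ∂μ ∂μ := by
    rw [hS1, lintegral_lintegral_swap]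
    · simp only [hsymm]
    · refine Measurable.aemeasurable ?_
      exact hk.mul (((hf.comp measurable_fst).pow_const 2).mul
        ((ENNReal.measurable_ofReal.comp (hh.comp measurable_fst)).inv.mul
          (ENNReal.measurable_ofReal.comp (hh.comp measurable_snd))))
  -- `2 f(x) f(y) ≤ f(x)² h(y) / h(x) + f(y)² h(x) / h(y)`, and the kernel is symmetric
  have h2 : 2 * ∫⁻ x, f x * ∫⁻ y, k x y * f y ∂μ ∂μ ≤ 2 * S := by
    calc _ = ∫⁻ x, ∫⁻ y, k x y * (2 * (f x * f y)) ∂μ ∂μ := by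
          rw [← lintegral_const_mul' _ _ (by simp)]
          refine lintegral_congr fun x => ?_
          have hkx : Measurable (k x) := hk.comp measurable_prodMk_left
          rw [← mul_assoc, ← lintegral_const_mul _ (by fun_prop)]
          refine lintegral_congr fun y => ?_
          ring
      _ ≤ ∫⁻ x, ∫⁻ y, (k x y * (f x ^ 2 * ((ENNReal.ofReal (h x))⁻¹ * ENNReal.ofReal (h y))) +
            k x y * (f y ^ 2 * ((ENNReal.ofReal (h y))⁻¹ * ENNReal.ofReal (h x)))) ∂μ ∂μ := by
          refine lintegral_mono_ae ?_
          filter_upwards [hpos] with x hx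
          refine lintegral_mono_ae ?_
          filter_upwards [hpos] with y hy
          rw [← mul_add]
          gcongr
          exact amgm _ _ _ _ hx hy
      _ = S + S := by
          conv_rhs => rw [hS1]
          nth_rewrite 2 [← hS1]
          rw [hS2, ← lintegral_add_left]
          · refine lintegral_congr fun x => ?_
            have hkx : Measurable (k x) := hk.comp measurable_prodMk_left
            rw [lintegral_add_left (by fun_prop)]
          · have : Measurable (Function.uncurry fun x y => k x y *
                (f x ^ 2 * ((ENNReal.ofReal (h x))⁻¹ * ENNReal.ofReal (h y)))) :=
              hk.mul (((hf.comp measurable_fst).pow_const 2).mul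
                ((ENNReal.measurable_ofReal.comp (hh.comp measurable_fst)).inv.mul
                (ENNReal.measurable_ofReal.comp (hh.comp measurable_snd))))
            exact this.lintegral_prod_right'
      _ = 2 * S := (two_mul S).symm
  exact (ENNReal.mul_le_mul_iff_right (by simp) (by simp)).1 h2

theorem ofReal_integral_gaussian_mul_sq_le {d : ℕ} (U : 𝓢(EuclideanSpace ℝ (Fin d), ℂ)) {τ : ℝ}
    (hτ : 0 < τ) {h : EuclideanSpace ℝ (Fin d) → ℝ} (hh : Measurable h)
    (hpos : ∀ᵐ x, 0 < h x) :
    ∫⁻ x, ENNReal.ofReal (exp (-(π ^ 2 * ‖x‖ ^ 2 * τ))) * ‖U x‖ₑ ^ 2 ≤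
      ENNReal.ofReal ((π * τ) ^ (-((d : ℝ) / 2))) *
      ∫⁻ ξ, ‖𝓕 U ξ‖ₑ ^ 2 * (ENNReal.ofReal (h ξ))⁻¹ *
        ∫⁻ η, ENNReal.ofReal (exp (-(‖ξ - η‖ ^ 2 / τ))) * ENNReal.ofReal (h η) := by
  have hc := U.continuous
  have hL : ∫⁻ x, ENNReal.ofReal (exp (-(π ^ 2 * ‖x‖ ^ 2 * τ))) * ‖U x‖ₑ ^ 2 =
      ENNReal.ofReal (∫ x, exp (-(π ^ 2 * ‖x‖ ^ 2 * τ)) * ‖U x‖ ^ 2) := by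
    rw [ofReal_integral_eq_lintegral_ofReal]
    · refine lintegral_congr fun x => ?_
      rw [ENNReal.ofReal_mul (by positivity), ENNReal.ofReal_pow (by positivity), ofReal_norm]
    · have h2 : Integrable fun x => ‖U x‖ ^ 2 := (U.memLp 2 volume).integrable_norm_pow (by simp)
      refine h2.bdd_mul (c := 1) (by fun_prop) (Filter.Eventually.of_forall fun x => ?_)
      rw [Real.norm_of_nonneg (by positivity), exp_le_one_iff]
      simp only [Left.neg_nonpos_iff]
      positivity
    · exact Filter.Eventually.of_forall fun x => by positivity
  have hcF : Continuous fun ξ => 𝓕 U ξ := (𝓕 U).continuous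
  have heC : ∀ r : ℝ, ‖(r : ℂ)‖ₑ = ‖r‖ₑ := fun r => by simp [enorm_eq_nnnorm]
  rw [hL]
  have h1 : ENNReal.ofReal ((π * τ) ^ ((d : ℝ) / 2) *
      ∫ x, exp (-(π ^ 2 * ‖x‖ ^ 2 * τ)) * ‖U x‖ ^ 2) ≤ ∫⁻ ξ, ‖𝓕 U ξ‖ₑ ^ 2 *
      (ENNReal.ofReal (h ξ))⁻¹ *
        ∫⁻ η, ENNReal.ofReal (exp (-(‖ξ - η‖ ^ 2 / τ))) * ENNReal.ofReal (h η) := by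
    have h3 : 0 ≤ (π * τ) ^ ((d : ℝ) / 2) * ∫ x, exp (-(π ^ 2 * ‖x‖ ^ 2 * τ)) * ‖U x‖ ^ 2 := by
      have : 0 ≤ ∫ x, exp (-(π ^ 2 * ‖x‖ ^ 2 * τ)) * ‖U x‖ ^ 2 :=
        integral_nonneg fun x => by positivity
      positivity
    rw [← Real.enorm_of_nonneg h3, ← heC, integral_gaussian_mul_sq_eq U hτ]
    refine le_trans (enorm_integral_le_lintegral_enorm _) ?_
    refine le_trans (lintegral_mono fun ξ => ?_)
      (lintegral_lintegral_symm_kernel_le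
      (k := fun ξ η => ENNReal.ofReal (exp (-(‖ξ - η‖ ^ 2 / τ))))
      (by unfold Function.uncurry; fun_prop) (fun x y => by rw [norm_sub_rev])
      (hcF.enorm.measurable) hh hpos)
    rw [enorm_mul, RCLike.enorm_conj]
    gcongr
    refine le_trans (enorm_integral_le_lintegral_enorm _) (le_of_eq ?_)
    refine lintegral_congr fun η => ?_
    rw [enorm_mul, heC, Real.enorm_of_nonneg (by positivity)]
  rw [ENNReal.ofReal_mul (by positivity)] at h1
  calc _ = ENNReal.ofReal ((π * τ) ^ (-((d : ℝ) / 2))) * (ENNReal.ofReal ((π * τ) ^ ((d : ℝ) / 2)) *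
      ENNReal.ofReal (∫ x, exp (-(π ^ 2 * ‖x‖ ^ 2 * τ)) * ‖U x‖ ^ 2)) := by
        rw [← mul_assoc, ← ENNReal.ofReal_mul (by positivity), ← rpow_add (by positivity)]
        simp
    _ ≤ _ := by gcongr

theorem measurable_heat_average {d : ℕ} {h : EuclideanSpace ℝ (Fin d) → ℝ} (hh : Measurable h) :
    Measurable fun p : ℝ × EuclideanSpace ℝ (Fin d) =>
      ∫⁻ η, ENNReal.ofReal (exp (-(‖p.2 - η‖ ^ 2 / p.1))) * ENNReal.ofReal (h η) :=
  Measurable.lintegral_prod_right' (f := fun q : (ℝ × EuclideanSpace ℝ (Fin d)) ×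
    EuclideanSpace ℝ (Fin d) => ENNReal.ofReal (exp (-(‖q.1.2 - q.2‖ ^ 2 / q.1.1))) *
      ENNReal.ofReal (h q.2)) (by fun_prop)

/-- The weight `‖x‖^(-2s)` as a superposition of Gaussians. -/
theorem lintegral_gaussian_mellin {d : ℕ} (hd : 1 ≤ d) {s : ℝ} (hs : 0 < s)
    {f : EuclideanSpace ℝ (Fin d) → ENNReal} (hf : Measurable f) :
    ENNReal.ofReal (Gamma s * π ^ (-(2 * s))) *
      ∫⁻ x, ENNReal.ofReal (‖x‖ ^ (-(2 * s))) * f x =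
    ∫⁻ τ in Ioi (0 : ℝ), ENNReal.ofReal (τ ^ (s - 1)) *
      ∫⁻ x, ENNReal.ofReal (exp (-(π ^ 2 * ‖x‖ ^ 2 * τ))) * f x := by
  have : Nonempty (Fin d) := ⟨⟨0, hd⟩⟩
  have hG := Gamma_pos_of_pos hs
  calc _ = ∫⁻ x, ∫⁻ τ in Ioi (0 : ℝ), f x *
        ENNReal.ofReal (τ ^ (s - 1) * exp (-(π ^ 2 * ‖x‖ ^ 2 * τ))) := by
        rw [← lintegral_const_mul' _ _ ENNReal.ofReal_ne_top]
        refine lintegral_congr_ae ?_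
        filter_upwards [compl_mem_ae_iff.2 (measure_singleton (0 : EuclideanSpace ℝ (Fin d)))]
          with x hx
        have hx' : 0 < ‖x‖ := norm_pos_iff.2 hx
        rw [lintegral_const_mul _ (by fun_prop), lintegral_rpow_mul_exp_neg_mul hs (by positivity),
          ← mul_assoc, mul_comm, ← ENNReal.ofReal_mul (by positivity)]
        congr 2
        rw [mul_rpow (by positivity) (by positivity), ← rpow_natCast, ← rpow_natCast,
          ← rpow_mul (by positivity), ← rpow_mul (by positivity)]
        push_cast
        ring_nf
    _ = ∫⁻ τ in Ioi (0 : ℝ), ∫⁻ x, f x *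
        ENNReal.ofReal (τ ^ (s - 1) * exp (-(π ^ 2 * ‖x‖ ^ 2 * τ))) :=
        lintegral_lintegral_swap (by fun_prop)
    _ = _ := by
        refine setLIntegral_congr_fun measurableSet_Ioi fun τ (hτ : 0 < τ) => ?_
        rw [← lintegral_const_mul' _ _ ENNReal.ofReal_ne_top]
        refine lintegral_congr fun x => ?_
        rw [ENNReal.ofReal_mul (by positivity)]
        ring

theorem lintegral_mul_lintegral_swap {α β : Type*} [MeasurableSpace α] [MeasurableSpace β]
    {μ : Measure α} {ν : Measure β} [SFinite μ] [SFinite ν] {A : α → ENNReal} (hA : Measurable A)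
    {B : α × β → ENNReal} (hB : Measurable B) {f : β → ENNReal} (hf : Measurable f) :
    ∫⁻ t, A t * ∫⁻ x, f x * B (t, x) ∂ν ∂μ = ∫⁻ x, f x * ∫⁻ t, A t * B (t, x) ∂μ ∂ν := by
  calc _ = ∫⁻ t, ∫⁻ x, f x * (A t * B (t, x)) ∂ν ∂μ := by
        refine lintegral_congr fun t => ?_
        rw [← lintegral_const_mul _ (by fun_prop)]
        refine lintegral_congr fun x => ?_
        rw [mul_left_comm]
    _ = ∫⁻ x, ∫⁻ t, f x * (A t * B (t, x)) ∂μ ∂ν := lintegral_lintegral_swap (by fun_prop)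
    _ = _ := by
        refine lintegral_congr fun x => ?_
        rw [lintegral_const_mul _ (by fun_prop)]

theorem lintegral_heat_average {d : ℕ} (s : ℝ) {h : EuclideanSpace ℝ (Fin d) → ℝ}
    (hh : Measurable h) {f : EuclideanSpace ℝ (Fin d) → ENNReal} (hf : Measurable f) :
    ∫⁻ τ in Ioi (0 : ℝ), ENNReal.ofReal (τ ^ (s - 1)) *
      (ENNReal.ofReal ((π * τ) ^ (-((d : ℝ) / 2))) * ∫⁻ ξ, f ξ *
        ∫⁻ η, ENNReal.ofReal (exp (-(‖ξ - η‖ ^ 2 / τ))) * ENNReal.ofReal (h η)) =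
    ∫⁻ ξ, f ξ * heatPotential s (fun η => ENNReal.ofReal (h η)) ξ := by
  have hA : Measurable fun τ : ℝ =>
    ENNReal.ofReal (τ ^ (s - 1) * (π * τ) ^ (-((d : ℝ) / 2))) := by fun_prop
  simp only [heatPotential]
  rw [← lintegral_mul_lintegral_swap (μ := volume.restrict (Ioi 0)) hA
    (measurable_heat_average hh) hf]
  refine setLIntegral_congr_fun measurableSet_Ioi fun τ (hτ : 0 < τ) => ?_
  rw [← mul_assoc, ← ENNReal.ofReal_mul (by positivity)]

/-- The Hardy term is bounded by a multiplication operator on the Fourier side, for every positive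
weight `h`: the Schur test for each Gaussian, integrated over the scale `τ`. The weight
`h = ‖ξ‖^(-(d/2+s))` would give the sharp Hardy inequality. -/
theorem lintegral_hardyTerm_le_heatPotential {d : ℕ} (hd : 1 ≤ d) {s : ℝ} (hs : 0 < s)
    (U : 𝓢(EuclideanSpace ℝ (Fin d), ℂ))
    {h : EuclideanSpace ℝ (Fin d) → ℝ} (hh : Measurable h) (hpos : ∀ᵐ x, 0 < h x) :
    ENNReal.ofReal (Gamma s * π ^ (-(2 * s))) *
      ∫⁻ x, ENNReal.ofReal (‖x‖ ^ (-(2 * s))) * ‖U x‖ₑ ^ 2 ≤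
    ∫⁻ ξ, ‖𝓕 U ξ‖ₑ ^ 2 * (ENNReal.ofReal (h ξ))⁻¹ *
      heatPotential s (fun η => ENNReal.ofReal (h η)) ξ := by
  have hcF : Measurable fun ξ => ‖𝓕 U ξ‖ₑ := (𝓕 U).continuous.enorm.measurable
  rw [lintegral_gaussian_mellin hd hs (U.continuous.enorm.measurable.pow_const 2),
    ← lintegral_heat_average s hh (f := fun ξ => ‖𝓕 U ξ‖ₑ ^ 2 * (ENNReal.ofReal (h ξ))⁻¹)
      (by fun_prop)]
  refine setLIntegral_mono' measurableSet_Ioi fun τ (hτ : 0 < τ) => ?_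
  gcongr
  exact ofReal_integral_gaussian_mul_sq_le U hτ hh hpos

/-! ### The Hardy inequality with a remainder -/

theorem SchwartzMap.integrable_rpow_mul_sq {d : ℕ} (f : 𝓢(EuclideanSpace ℝ (Fin d), ℂ)) {r : ℝ}
    (hr : 0 ≤ r) : Integrable fun ξ => ‖ξ‖ ^ r * ‖f ξ‖ ^ 2 := by
  obtain ⟨k, hk⟩ := exists_nat_ge r
  obtain ⟨A, hA⟩ := f.decay 0 0
  have h1 := (f.integrable_pow_mul volume 0).const_mul A
  have h2 := (f.integrable_pow_mul volume k).const_mul A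
  have hc := f.continuous
  refine (h1.add h2).mono' ?_ (Filter.Eventually.of_forall fun x => ?_)
  · have : Continuous fun x : EuclideanSpace ℝ (Fin d) => ‖x‖ ^ r :=
      continuous_norm.rpow_const (fun _ => Or.inr hr)
    exact (this.mul (hc.norm.pow 2)).aestronglyMeasurable
  · have hAx := hA.2 x
    simp only [norm_iteratedFDeriv_zero, pow_zero, one_mul] at hAx
    have hx : ‖x‖ ^ r ≤ 1 + ‖x‖ ^ k := by
      rcases le_total ‖x‖ 1 with h | h
      · have := rpow_le_one (norm_nonneg x) h hr
        have : 0 ≤ ‖x‖ ^ k := by positivity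
        linarith
      · have := rpow_le_rpow_of_exponent_le h hk
        rw [rpow_natCast] at this
        linarith
    rw [Real.norm_of_nonneg (by positivity)]
    simp only [Pi.add_apply, pow_zero, one_mul]
    calc ‖x‖ ^ r * ‖f x‖ ^ 2 ≤ (1 + ‖x‖ ^ k) * (A * ‖f x‖) := by
          rw [pow_two]; gcongr
      _ = _ := by ring

theorem heatPotential_add_le {d : ℕ} (s : ℝ) {h g₀ g₁ g₂ : EuclideanSpace ℝ (Fin d) → ENNReal}
    {a b : ENNReal} (hg₀ : Measurable g₀) (hg₁ : Measurable g₁) (hg₂ : Measurable g₂)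
    (hle : ∀ η, h η + a * g₁ η ≤ g₀ η + b * g₂ η) (hh : Measurable h)
    (ξ : EuclideanSpace ℝ (Fin d)) :
    heatPotential s h ξ + a * heatPotential s g₁ ξ ≤
      heatPotential s g₀ ξ + b * heatPotential s g₂ ξ := by
  have hm : ∀ {g : EuclideanSpace ℝ (Fin d) → ENNReal}, Measurable g → Measurable fun τ : ℝ =>
      ENNReal.ofReal (τ ^ (s - 1) * (π * τ) ^ (-((d : ℝ) / 2))) *
      ∫⁻ η, ENNReal.ofReal (exp (-(‖ξ - η‖ ^ 2 / τ))) * g η := fun {g} hg => by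
    have : Measurable fun τ : ℝ => ∫⁻ η, ENNReal.ofReal (exp (-(‖ξ - η‖ ^ 2 / τ))) * g η :=
      Measurable.lintegral_prod_right' (f := fun q : ℝ × EuclideanSpace ℝ (Fin d) =>
        ENNReal.ofReal (exp (-(‖ξ - q.2‖ ^ 2 / q.1))) * g q.2) (by fun_prop)
    fun_prop
  simp only [heatPotential]
  rw [← lintegral_const_mul _ (hm hg₁), ← lintegral_const_mul _ (hm hg₂),
    ← lintegral_add_left (hm hh), ← lintegral_add_left (hm hg₀)]
  refine lintegral_mono fun τ => ?_
  rw [mul_left_comm a, mul_left_comm b, ← mul_add, ← mul_add]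
  refine mul_le_mul' le_rfl ?_
  rw [← lintegral_const_mul _ (by fun_prop), ← lintegral_const_mul _ (by fun_prop),
    ← lintegral_add_left (by fun_prop), ← lintegral_add_left (by fun_prop)]
  refine lintegral_mono fun η => ?_
  rw [mul_left_comm a, mul_left_comm b, ← mul_add, ← mul_add]
  refine mul_le_mul' le_rfl ?_
  exact hle η

/-- The terms of higher order in `μ` are absorbed by the term of first order and a constant. The
powers of `μ` and `w` are homogeneous of total degree `n + 3`, so only the ratio `w / μ` matters.
-/
theorem exists_perturbed_power_bound {c b k : ℝ} (hc : 0 < c) (hb : 0 ≤ b) (hk : 0 ≤ k) (n : ℕ) :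
    ∃ K : ℝ, 0 ≤ K ∧ ∀ μ w : ℝ, 0 < μ → 0 < w →
      b * (w ^ (n + 1) * μ ^ 2) + k * (w ^ n * μ ^ 3) ≤
        c * (w ^ (n + 2) * μ) + K * μ ^ (n + 3) := by
  set Z : ℝ := 1 + (b + k) / c with hZ
  have hZ1 : 1 ≤ Z := by
    have : 0 ≤ (b + k) / c := by positivity
    linarith
  have hZc : b + k ≤ c * Z := by
    rw [hZ, mul_add, mul_div_cancel₀ _ hc.ne']
    linarith
  refine ⟨(b + k) * Z ^ (n + 1), by positivity, fun μ w hμ hw => ?_⟩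
  obtain ⟨z, hz, rfl⟩ : ∃ z, 0 < z ∧ w = μ * z := ⟨w / μ, by positivity, by field_simp⟩
  have key : b * z ^ (n + 1) + k * z ^ n ≤ c * z ^ (n + 2) + (b + k) * Z ^ (n + 1) := by
    rcases le_total z Z with h | h
    · have h1 : z ^ (n + 1) ≤ Z ^ (n + 1) := by gcongr
      have h2 : z ^ n ≤ Z ^ (n + 1) :=
        (pow_le_pow_left₀ hz.le h n).trans (pow_le_pow_right₀ hZ1 (Nat.le_succ n))
      have h3 : 0 ≤ c * z ^ (n + 2) := by positivity
      have h4 := mul_le_mul_of_nonneg_left h1 hb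
      have h5 := mul_le_mul_of_nonneg_left h2 hk
      linarith
    · have h2 : z ^ n ≤ z ^ (n + 1) := pow_le_pow_right₀ (hZ1.trans h) (Nat.le_succ n)
      have h5 := mul_le_mul_of_nonneg_left h2 hk
      have h6 : (b + k) * z ^ (n + 1) ≤ c * z * z ^ (n + 1) := by
        gcongr
        exact hZc.trans (by gcongr)
      have h7 : 0 ≤ (b + k) * Z ^ (n + 1) := by positivity
      have h8 : c * z * z ^ (n + 1) = c * z ^ (n + 2) := by ring
      linarith
  have := mul_le_mul_of_nonneg_left key (by positivity : 0 ≤ μ ^ (n + 3))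
  calc _ = μ ^ (n + 3) * (b * z ^ (n + 1) + k * z ^ n) := by ring
    _ ≤ _ := this
    _ = _ := by ring

/-- The trial weight `|ξ|^(-a) / (1 + μ |ξ|^(-ε))` for the Schur test, a perturbation of the power
`|ξ|^(-a)`. Its value at `ξ = 0` is irrelevant (it is `0` for `a ≠ 0`). -/
noncomputable def trialWeight {d : ℕ} (a ε μ : ℝ) (ξ : EuclideanSpace ℝ (Fin d)) : ℝ :=
  ‖ξ‖ ^ (-a) / (1 + μ * ‖ξ‖ ^ (-ε))

theorem measurable_trialWeight {d : ℕ} (a ε μ : ℝ) :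
    Measurable (trialWeight (d := d) a ε μ) := by
  unfold trialWeight
  fun_prop

/-- With `y = μ ‖ξ‖^(-ε)`, this is `1 / (1 + y) + y ≤ 1 + y²`. At `ξ = 0` all the powers are `0`.
-/
theorem trialWeight_add_le {d : ℕ} {a ε μ : ℝ} (ha : 0 < a) (hε : 0 < ε) (hμ : 0 < μ)
    (ξ : EuclideanSpace ℝ (Fin d)) :
    trialWeight a ε μ ξ + μ * ‖ξ‖ ^ (-(a + ε)) ≤
      ‖ξ‖ ^ (-a) + μ ^ 2 * ‖ξ‖ ^ (-(a + 2 * ε)) := by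
  rcases eq_or_ne ξ 0 with rfl | hξ
  · have h1 : -a ≠ 0 := by linarith
    have h2 : -(a + ε) ≠ 0 := by linarith
    have h3 : -(a + 2 * ε) ≠ 0 := by linarith
    simp only [trialWeight, norm_zero, zero_rpow h1, zero_rpow h2, zero_rpow h3]
    simp
  · have hx : 0 < ‖ξ‖ := norm_pos_iff.2 hξ
    rw [trialWeight, show -(a + ε) = -a + -ε by ring,
      show -(a + 2 * ε) = -a + -ε + -ε by ring, rpow_add hx, rpow_add hx, rpow_add hx]
    have hA : 0 < ‖ξ‖ ^ (-a) := by positivity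
    have hB : 0 < ‖ξ‖ ^ (-ε) := by positivity
    generalize ‖ξ‖ ^ (-a) = A at *
    generalize ‖ξ‖ ^ (-ε) = B at *
    rw [← sub_nonneg]
    have : A + μ ^ 2 * (A * B * B) - (A / (1 + μ * B) + μ * (A * B)) =
        A * (μ * B) ^ 3 / (1 + μ * B) := by
      field_simp; ring
    rw [this]
    positivity

/-- The multiplier produced by the Schur test with the trial weight. Since `y = μ ‖ξ‖^(-ε)` enters
the weight with a minus sign and the power `d/2 + s + ε` has the larger Riesz constant, the term
of first order in `y` is a gain. -/
theorem trialWeight_heatPotential_le {d n : ℕ} (hd : 1 ≤ d) {s ε c K μ : ℝ} (hs : 0 < s)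
    (hε : 0 < ε) (hεn : ε * (n + 3) = 2 * s) (hεd : 2 * ε < d / 2 - s) (hμ : 0 < μ)
    {κ : ℝ → ℝ} (hκ : κ = fun a => Gamma (a / 2 - s) * Gamma ((d - a) / 2) /
        (Gamma (a / 2) * Gamma (s + (d - a) / 2)))
    (hc : c = κ (d / 2 + s + ε) - κ (d / 2 + s)) (hc0 : 0 ≤ c)
    (hK : ∀ w : ℝ, 0 < w →
      κ (d / 2 + s + 2 * ε) * (w ^ (n + 1) * μ ^ 2) +
        κ (d / 2 + s + 2 * ε) * (w ^ n * μ ^ 3) ≤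
        c / 2 * (w ^ (n + 2) * μ) + K * μ ^ (n + 3))
    {ξ : EuclideanSpace ℝ (Fin d)} (hξ : ξ ≠ 0) :
    (ENNReal.ofReal (trialWeight (d / 2 + s) ε μ ξ))⁻¹ *
        heatPotential s (fun η => ENNReal.ofReal (trialWeight (d / 2 + s) ε μ η)) ξ +
      ENNReal.ofReal (Gamma s * (c / 2 * μ * ‖ξ‖ ^ (2 * s - ε))) ≤
      ENNReal.ofReal (Gamma s * (κ (d / 2 + s) * ‖ξ‖ ^ (2 * s) + K * μ ^ (n + 3))) := by
  have hx : 0 < ‖ξ‖ := norm_pos_iff.2 hξ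
  have hn0 : (0 : ℝ) ≤ n := n.cast_nonneg
  have hd0 : (0 : ℝ) < d := by exact_mod_cast hd
  have hκpos : ∀ a, 2 * s < a → a < d → 0 < κ a := fun a h1 h2 => by
    rw [hκ]
    have := Gamma_pos_of_pos (show 0 < a / 2 - s by linarith)
    have := Gamma_pos_of_pos (show 0 < (d - a) / 2 by linarith)
    have := Gamma_pos_of_pos (show 0 < a / 2 by linarith)
    have := Gamma_pos_of_pos (show 0 < s + (d - a) / 2 by linarith)
    positivity
  have hT : ∀ a, 2 * s < a → a < d →
      heatPotential s (fun η : EuclideanSpace ℝ (Fin d) => ENNReal.ofReal (‖η‖ ^ (-a))) ξ =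
        ENNReal.ofReal (Gamma s * κ a * ‖ξ‖ ^ (2 * s - a)) := fun a h1 h2 => by
    rw [heatPotential_rpow hd hs h1 h2 hξ, hκ]
  have hΓ := Gamma_pos_of_pos hs
  have k0 := hκpos (d / 2 + s) (by linarith) (by linarith)
  have k1 := hκpos (d / 2 + s + ε) (by linarith) (by linarith)
  have k2 := hκpos (d / 2 + s + 2 * ε) (by linarith) (by linarith)
  have hadd := heatPotential_add_le s
    (h := fun η => ENNReal.ofReal (trialWeight (d / 2 + s) ε μ η))
    (g₀ := fun η : EuclideanSpace ℝ (Fin d) => ENNReal.ofReal (‖η‖ ^ (-((d : ℝ) / 2 + s))))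
    (g₁ := fun η : EuclideanSpace ℝ (Fin d) => ENNReal.ofReal (‖η‖ ^ (-((d : ℝ) / 2 + s + ε))))
    (g₂ := fun η : EuclideanSpace ℝ (Fin d) =>
      ENNReal.ofReal (‖η‖ ^ (-((d : ℝ) / 2 + s + 2 * ε))))
    (a := ENNReal.ofReal μ) (b := ENNReal.ofReal (μ ^ 2)) (by fun_prop) (by fun_prop) (by fun_prop)
    (fun η => by
      have hw : 0 ≤ trialWeight (d / 2 + s) ε μ η := by
        unfold trialWeight; positivity
      rw [← ENNReal.ofReal_mul (by positivity), ← ENNReal.ofReal_mul (by positivity),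
        ← ENNReal.ofReal_add hw (by positivity),
        ← ENNReal.ofReal_add (by positivity) (by positivity)]
      exact ENNReal.ofReal_le_ofReal (trialWeight_add_le (by linarith) hε hμ η))
    (ENNReal.measurable_ofReal.comp (measurable_trialWeight _ _ _)) ξ
  rw [hT _ (by linarith) (by linarith), hT _ (by linarith) (by linarith),
    hT _ (by linarith) (by linarith), ← ENNReal.ofReal_mul (by positivity),
    ← ENNReal.ofReal_mul (by positivity), ← ENNReal.ofReal_add (by positivity) (by positivity)]
    at hadd
  have hfin : heatPotential s (fun η => ENNReal.ofReal (trialWeight (d / 2 + s) ε μ η)) ξ ≠ ⊤ :=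
    ne_top_of_le_ne_top ENNReal.ofReal_ne_top (le_trans le_self_add hadd)
  obtain ⟨p, hp, hpe⟩ : ∃ p : ℝ, 0 ≤ p ∧
      heatPotential s (fun η => ENNReal.ofReal (trialWeight (d / 2 + s) ε μ η)) ξ =
        ENNReal.ofReal p := ⟨_, ENNReal.toReal_nonneg, (ENNReal.ofReal_toReal hfin).symm⟩
  rw [hpe, ← ENNReal.ofReal_add hp (by positivity),
    ENNReal.ofReal_le_ofReal_iff (by positivity)] at hadd
  have hw : 0 < trialWeight (d / 2 + s) ε μ ξ := by
    unfold trialWeight; positivity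
  rw [hpe, ← ENNReal.ofReal_inv_of_pos hw, ← ENNReal.ofReal_mul (by positivity)]
  rw [← ENNReal.ofReal_add (by positivity) (by positivity)]
  refine ENNReal.ofReal_le_ofReal ?_
  have hX : 0 < ‖ξ‖ ^ ε := by positivity
  have hpow : ∀ k : ℕ, ‖ξ‖ ^ (ε * k) = (‖ξ‖ ^ ε) ^ k := fun k => by
    rw [rpow_mul hx.le, rpow_natCast]
  have e0 : ‖ξ‖ ^ (2 * s) = (‖ξ‖ ^ ε) ^ (n + 3) := by
    rw [← hpow, ← hεn]; push_cast; rfl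
  have e1 : ‖ξ‖ ^ (2 * s - ε) = (‖ξ‖ ^ ε) ^ (n + 2) := by
    rw [← hpow, ← hεn]; push_cast; congr 1; ring
  have e2 : ‖ξ‖ ^ (2 * s - 2 * ε) = (‖ξ‖ ^ ε) ^ (n + 1) := by
    rw [← hpow, ← hεn]; push_cast; congr 1; ring
  have hsplit : ∀ b, ‖ξ‖ ^ (2 * s - (d / 2 + s + b)) =
      ‖ξ‖ ^ (-((d : ℝ) / 2 + s)) * ‖ξ‖ ^ (2 * s - b) := fun b => by
    rw [← rpow_add hx]; congr 1; ring
  have hsplit0 := hsplit 0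
  rw [add_zero, sub_zero] at hsplit0
  rw [hsplit0, hsplit, hsplit, e0, e1, e2] at hadd
  rw [e0, e1]
  have hA : 0 < ‖ξ‖ ^ (-((d : ℝ) / 2 + s)) := by positivity
  have hKX := hK _ hX
  have hwe : trialWeight (d / 2 + s) ε μ ξ = ‖ξ‖ ^ (-((d : ℝ) / 2 + s)) / (1 + μ / ‖ξ‖ ^ ε) := by
    rw [trialWeight, rpow_neg hx.le ε, div_eq_mul_inv μ]
  rw [hwe]
  generalize ‖ξ‖ ^ ε = X at *
  generalize ‖ξ‖ ^ (-((d : ℝ) / 2 + s)) = A at *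
  generalize κ (d / 2 + s) = κ₀ at *
  generalize κ (d / 2 + s + ε) = κ₁ at *
  generalize κ (d / 2 + s + 2 * ε) = κ₂ at *
  generalize Gamma s = G at *
  -- the factor `1 + μ / X` from the reciprocal of the weight turns the coefficient `-κ₁` of
  -- `μ` into `κ₀ - κ₁ = -c`
  have h1 : (A / (1 + μ / X))⁻¹ * p ≤ (A / (1 + μ / X))⁻¹ *
      (G * κ₀ * (A * X ^ (n + 3)) + μ ^ 2 * (G * κ₂ * (A * X ^ (n + 1))) -
        μ * (G * κ₁ * (A * X ^ (n + 2)))) := by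
    gcongr
    linarith
  have h2 : (A / (1 + μ / X))⁻¹ *
      (G * κ₀ * (A * X ^ (n + 3)) + μ ^ 2 * (G * κ₂ * (A * X ^ (n + 1))) -
        μ * (G * κ₁ * (A * X ^ (n + 2)))) =
      G * (κ₀ * X ^ (n + 3) - c * (X ^ (n + 2) * μ) + (κ₂ * (X ^ (n + 1) * μ ^ 2) +
        κ₂ * (X ^ n * μ ^ 3)) - κ₁ * (X ^ (n + 1) * μ ^ 2)) := by
    rw [hc]
    field_simp
    ring
  have h3 : 0 ≤ κ₁ * (X ^ (n + 1) * μ ^ 2) := by positivity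
  have h4 : G * (κ₀ * X ^ (n + 3) - c * (X ^ (n + 2) * μ) + (κ₂ * (X ^ (n + 1) * μ ^ 2) +
        κ₂ * (X ^ n * μ ^ 3)) - κ₁ * (X ^ (n + 1) * μ ^ 2)) ≤
      G * (κ₀ * X ^ (n + 3) - c / 2 * μ * X ^ (n + 2) + K * μ ^ (n + 3)) := by
    gcongr
    linarith
  linarith

/-- The Riesz constant at the exponent `d/2 + s` is the reciprocal of the Hardy constant, up to
the factor `2^(2s)`. -/
theorem hardyConst_mul_Gamma_ratio {d : ℕ} {s : ℝ} (hs : 0 < s) (hsd : s < (d : ℝ) / 2) :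
    hardyConst s d * (Gamma ((d / 2 + s) / 2 - s) * Gamma ((d - (d / 2 + s)) / 2) /
        (Gamma ((d / 2 + s) / 2) * Gamma (s + (d - (d / 2 + s)) / 2))) = 2 ^ (2 * s) := by
  have h1 := Gamma_pos_of_pos (show 0 < ((d : ℝ) + 2 * s) / 4 by linarith)
  have h2 := Gamma_pos_of_pos (show 0 < ((d : ℝ) - 2 * s) / 4 by linarith)
  rw [hardyConst, show ((d : ℝ) / 2 + s) / 2 - s = (d - 2 * s) / 4 by ring,
    show ((d : ℝ) - (d / 2 + s)) / 2 = (d - 2 * s) / 4 by ring,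
    show ((d : ℝ) / 2 + s) / 2 = (d + 2 * s) / 4 by ring,
    show s + ((d : ℝ) - 2 * s) / 4 = (d + 2 * s) / 4 by ring]
  field_simp

/-- Hardy's inequality with a remainder of order `2s - ε`. The Fourier transform is Mathlib's,
whence the factor `(2π)^(2s)`. The free parameter `μ` is the scale of the remainder. -/
theorem improved_hardy {d n : ℕ} (hd : 1 ≤ d) {s ε : ℝ} (hs : 0 < s)
    (hε : 0 < ε) (hεn : ε * (n + 3) = 2 * s) (hεd : 2 * ε < d / 2 - s) :
    ∃ c K : ℝ, 0 < c ∧ 0 ≤ K ∧ ∀ U : 𝓢(EuclideanSpace ℝ (Fin d), ℂ), ∀ μ : ℝ, 0 < μ →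
      hardyConst s d * (∫ x, ‖x‖ ^ (-(2 * s)) * ‖U x‖ ^ 2) +
        c * μ * (∫ ξ, ‖ξ‖ ^ (2 * s - ε) * ‖𝓕 U ξ‖ ^ 2) ≤
      (2 * π) ^ (2 * s) * (∫ ξ, ‖ξ‖ ^ (2 * s) * ‖𝓕 U ξ‖ ^ 2) +
        K * μ ^ (n + 3) * ∫ x, ‖U x‖ ^ 2 := by
  have : Nonempty (Fin d) := ⟨⟨0, hd⟩⟩
  have hn0 : (0 : ℝ) ≤ n := n.cast_nonneg
  have hd0 : (0 : ℝ) < d := by exact_mod_cast hd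
  have hsd : s < (d : ℝ) / 2 := by linarith
  obtain ⟨κ, hκ⟩ : ∃ κ : ℝ → ℝ, κ = fun a => Gamma (a / 2 - s) * Gamma ((d - a) / 2) /
        (Gamma (a / 2) * Gamma (s + (d - a) / 2)) := ⟨_, rfl⟩
  have hκ2 : 0 ≤ κ (d / 2 + s + 2 * ε) := by
    rw [hκ]
    have := Gamma_pos_of_pos (show 0 < ((d : ℝ) / 2 + s + 2 * ε) / 2 - s by linarith)
    have := Gamma_pos_of_pos (show 0 < ((d : ℝ) - (d / 2 + s + 2 * ε)) / 2 by linarith)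
    have := Gamma_pos_of_pos (show 0 < ((d : ℝ) / 2 + s + 2 * ε) / 2 by linarith)
    have := Gamma_pos_of_pos (show 0 < s + ((d : ℝ) - (d / 2 + s + 2 * ε)) / 2 by linarith)
    positivity
  obtain ⟨c, hc⟩ : ∃ c, c = κ (d / 2 + s + ε) - κ (d / 2 + s) := ⟨_, rfl⟩
  have hc0 : 0 < c := by
    have h := Gamma_ratio_sq_lt (p := ((d : ℝ) / 2 - s) / 2) (s := s) (e := ε / 2) hs
      (by linarith) (by linarith)
    rw [hc, hκ, sub_pos]
    convert h using 3 <;> congr 1 <;> ring_nf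
  obtain ⟨K, hK0, hK⟩ := exists_perturbed_power_bound (half_pos hc0) hκ2 hκ2 n
  have hC0 : 0 < hardyConst s d := by
    unfold hardyConst
    have := Gamma_pos_of_pos (show 0 < ((d : ℝ) + 2 * s) / 4 by linarith)
    have := Gamma_pos_of_pos (show 0 < ((d : ℝ) - 2 * s) / 4 by linarith)
    positivity
  have hC : hardyConst s d * κ (d / 2 + s) = 2 ^ (2 * s) := by
    rw [hκ]; exact hardyConst_mul_Gamma_ratio hs hsd
  have hκ0 : 0 < κ (d / 2 + s) :=
    (mul_pos_iff_of_pos_left hC0).1 (hC.symm ▸ by positivity)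
  have hΓ := Gamma_pos_of_pos hs
  refine ⟨hardyConst s d * π ^ (2 * s) * (c / 2), hardyConst s d * π ^ (2 * s) * K,
    by positivity, by positivity, fun U μ hμ => ?_⟩
  have hae : ∀ᵐ ξ : EuclideanSpace ℝ (Fin d), ξ ≠ 0 :=
    compl_mem_ae_iff.2 (measure_singleton (0 : EuclideanSpace ℝ (Fin d)))
  have hpos : ∀ᵐ ξ : EuclideanSpace ℝ (Fin d), 0 < trialWeight (d / 2 + s) ε μ ξ := by
    filter_upwards [hae] with ξ hξ
    have hx : 0 < ‖ξ‖ := norm_pos_iff.2 hξ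
    unfold trialWeight; positivity
  have hschur := lintegral_hardyTerm_le_heatPotential hd hs U
    (measurable_trialWeight (d / 2 + s) ε μ) hpos
  have hcF := (𝓕 U).continuous
  have hcU := U.continuous
  have i1 := (𝓕 U).integrable_rpow_mul_sq (r := 2 * s - ε) (by nlinarith)
  have i2 := (𝓕 U).integrable_rpow_mul_sq (r := 2 * s) (by linarith)
  have i3 : Integrable fun ξ => ‖𝓕 U ξ‖ ^ 2 := by
    have h := (𝓕 U).integrable_rpow_mul_sq (r := 0) le_rfl
    simp only [rpow_zero, one_mul] at h
    exact h
  set H := ∫⁻ x, ENNReal.ofReal (‖x‖ ^ (-(2 * s))) * ‖U x‖ₑ ^ 2 with hH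
  have hHreal : ∫ x, ‖x‖ ^ (-(2 * s)) * ‖U x‖ ^ 2 = H.toReal := by
    rw [integral_eq_lintegral_of_nonneg_ae (Filter.Eventually.of_forall fun x => by positivity)
      (by fun_prop : Measurable _).aestronglyMeasurable]
    congr 1
    refine lintegral_congr fun x => ?_
    rw [ENNReal.ofReal_mul (by positivity), ENNReal.ofReal_pow (by positivity), ofReal_norm]
  have hmain : ENNReal.ofReal (Gamma s * π ^ (-(2 * s))) * H +
      ENNReal.ofReal (Gamma s * (c / 2) * μ * ∫ ξ, ‖ξ‖ ^ (2 * s - ε) * ‖𝓕 U ξ‖ ^ 2) ≤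
      ENNReal.ofReal (Gamma s * κ (d / 2 + s) * (∫ ξ, ‖ξ‖ ^ (2 * s) * ‖𝓕 U ξ‖ ^ 2) +
        Gamma s * K * μ ^ (n + 3) * ∫ ξ, ‖𝓕 U ξ‖ ^ 2) := by
    rw [← integral_const_mul, ← integral_const_mul, ← integral_const_mul, ← integral_add,
      ofReal_integral_eq_lintegral_ofReal, ofReal_integral_eq_lintegral_ofReal]
    · refine (add_le_add_left hschur _).trans ?_
      rw [← lintegral_add_right _ (by fun_prop)]
      refine lintegral_mono_ae ?_
      filter_upwards [hae] with ξ hξ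
      have h := trialWeight_heatPotential_le (K := K) hd hs hε hεn hεd hμ hκ hc hc0.le
        (fun w hw => hK μ w hμ hw) hξ
      have e1 : ‖𝓕 U ξ‖ₑ ^ 2 = ENNReal.ofReal (‖𝓕 U ξ‖ ^ 2) := by
        rw [ENNReal.ofReal_pow (by positivity), ofReal_norm]
      calc _ = ‖𝓕 U ξ‖ₑ ^ 2 * ((ENNReal.ofReal (trialWeight (d / 2 + s) ε μ ξ))⁻¹ *
            heatPotential s (fun η => ENNReal.ofReal (trialWeight (d / 2 + s) ε μ η)) ξ +
            ENNReal.ofReal (Gamma s * (c / 2 * μ * ‖ξ‖ ^ (2 * s - ε)))) := by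
            rw [mul_add, mul_assoc]
            congr 1
            rw [e1, ← ENNReal.ofReal_mul (by positivity)]
            congr 1
            ring
        _ ≤ ‖𝓕 U ξ‖ₑ ^ 2 *
            ENNReal.ofReal (Gamma s * (κ (d / 2 + s) * ‖ξ‖ ^ (2 * s) + K * μ ^ (n + 3))) := by
            gcongr
        _ = _ := by
            rw [e1, ← ENNReal.ofReal_mul (by positivity)]
            congr 1
            ring
    · exact (i2.const_mul _).add (i3.const_mul _)
    · exact Filter.Eventually.of_forall fun x => by positivity
    · exact i1.const_mul _
    · exact Filter.Eventually.of_forall fun x => by positivity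
    · exact i2.const_mul _
    · exact i3.const_mul _
  have hB1 : 0 ≤ ∫ ξ, ‖ξ‖ ^ (2 * s - ε) * ‖𝓕 U ξ‖ ^ 2 := integral_nonneg fun ξ => by positivity
  have hB2 : 0 ≤ ∫ ξ, ‖ξ‖ ^ (2 * s) * ‖𝓕 U ξ‖ ^ 2 := integral_nonneg fun ξ => by positivity
  have hB3 : 0 ≤ ∫ ξ, ‖𝓕 U ξ‖ ^ 2 := integral_nonneg fun ξ => by positivity
  have hreal := ENNReal.toReal_mono ENNReal.ofReal_ne_top hmain
  have hfin : ENNReal.ofReal (Gamma s * π ^ (-(2 * s))) * H ≠ ⊤ :=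
    ne_top_of_le_ne_top ENNReal.ofReal_ne_top (le_trans le_self_add hmain)
  rw [ENNReal.toReal_add hfin ENNReal.ofReal_ne_top, ENNReal.toReal_mul,
    ENNReal.toReal_ofReal (by positivity), ENNReal.toReal_ofReal (by positivity),
    ENNReal.toReal_ofReal (by positivity), ← hHreal, U.integral_norm_sq_fourier] at hreal
  have hmul := mul_le_mul_of_nonneg_left hreal
    (by positivity : 0 ≤ hardyConst s d * π ^ (2 * s) / Gamma s)
  have hππ : π ^ (2 * s) * π ^ (-(2 * s)) = 1 := by
    rw [← rpow_add pi_pos]; simp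
  rw [mul_rpow (by positivity) (by positivity), ← hC]
  calc _ = hardyConst s d * π ^ (2 * s) / Gamma s * (Gamma s * π ^ (-(2 * s)) *
          (∫ x, ‖x‖ ^ (-(2 * s)) * ‖U x‖ ^ 2) +
          Gamma s * (c / 2) * μ * ∫ ξ, ‖ξ‖ ^ (2 * s - ε) * ‖𝓕 U ξ‖ ^ 2) := by
        generalize ∫ x, ‖x‖ ^ (-(2 * s)) * ‖U x‖ ^ 2 = I
        generalize ∫ ξ, ‖ξ‖ ^ (2 * s - ε) * ‖𝓕 U ξ‖ ^ 2 = I'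
        rw [mul_add]
        congr 1
        · calc _ = hardyConst s d * I * (π ^ (2 * s) * π ^ (-(2 * s))) := by rw [hππ, mul_one]
            _ = _ := by field_simp
        · field_simp
    _ ≤ _ := hmul
    _ = _ := by field_simp

/-! ### The weak Sobolev inequality -/

theorem exists_setIntegral_ball_norm_rpow_le {d : ℕ} (hd : 1 ≤ d) {t : ℝ} (htd : 2 * t < d) :
    ∃ V : ℝ, 0 < V ∧ ∀ R : ℝ, 0 < R →
      IntegrableOn (fun ξ : EuclideanSpace ℝ (Fin d) => ‖ξ‖ ^ (-(2 * t))) (Metric.ball 0 R) ∧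
      ∫ ξ in Metric.ball (0 : EuclideanSpace ℝ (Fin d)) R, ‖ξ‖ ^ (-(2 * t)) ≤
        V * R ^ (d - 2 * t) := by
  set V := ∫ ξ in Metric.ball (0 : EuclideanSpace ℝ (Fin d)) 1, ‖ξ‖ ^ (-(2 * t)) with hV
  have hV0 : 0 ≤ V := integral_nonneg fun ξ => by positivity
  refine ⟨V + 1, by positivity, fun R hR => ⟨?_, ?_⟩⟩
  · refine integrableOn_ball_of_norm_le_rpow (C := 1) (α := 2 * t) (by simpa using hd)
      (by simpa using htd) (Filter.Eventually.of_forall fun ξ => ?_)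
      (by fun_prop : Measurable _).aestronglyMeasurable
    rw [Real.norm_of_nonneg (by positivity), one_mul]
  · have h := Measure.setIntegral_comp_smul_of_pos volume
      (fun ξ : EuclideanSpace ℝ (Fin d) => ‖ξ‖ ^ (-(2 * t))) (Metric.ball 0 1) hR
    rw [smul_unitBall_of_pos hR] at h
    simp only [norm_smul, Real.norm_of_nonneg hR.le, finrank_euclideanSpace, Fintype.card_fin,
      smul_eq_mul] at h
    have h2 : ∀ ξ : EuclideanSpace ℝ (Fin d), (R * ‖ξ‖) ^ (-(2 * t)) =
      R ^ (-(2 * t)) * ‖ξ‖ ^ (-(2 * t)) := fun ξ => mul_rpow hR.le (norm_nonneg _)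
    simp only [h2] at h
    rw [integral_const_mul, ← hV] at h
    have h3 : ∫ ξ in Metric.ball (0 : EuclideanSpace ℝ (Fin d)) R, ‖ξ‖ ^ (-(2 * t)) =
        V * R ^ (d - 2 * t) := by
      have h4 : R ^ ((d : ℝ) - 2 * t) = R ^ d * R ^ (-(2 * t)) := by
        rw [sub_eq_add_neg, rpow_add hR, rpow_natCast]
      rw [h4, mul_left_comm, mul_comm V, h]
      field_simp
    rw [h3]
    gcongr
    linarith

/-- Splitting of a Schwartz function into Schwartz functions of low and high frequency, with a
smooth cut-off. -/
theorem exists_frequency_splitting {d : ℕ} (U : 𝓢(EuclideanSpace ℝ (Fin d), ℂ)) {R : ℝ}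
    (hR : 0 < R) : ∃ V W : 𝓢(EuclideanSpace ℝ (Fin d), ℂ), (∀ x, U x = V x + W x) ∧
      (∀ ξ, ‖𝓕 V ξ‖ ≤ (Metric.ball (0 : EuclideanSpace ℝ (Fin d)) (2 * R)).indicator
        (fun ξ => ‖𝓕 U ξ‖) ξ) ∧
      (∀ ξ, ‖𝓕 W ξ‖ ≤ (Metric.ball (0 : EuclideanSpace ℝ (Fin d)) R)ᶜ.indicator
        (fun ξ => ‖𝓕 U ξ‖) ξ) := by
  let φ : ContDiffBump (0 : EuclideanSpace ℝ (Fin d)) := ⟨R, 2 * R, hR, by linarith⟩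
  have hcs : HasCompactSupport fun ξ => ((φ ξ : ℝ) : ℂ) * 𝓕 U ξ :=
    (φ.hasCompactSupport.comp_left (g := fun r : ℝ => (r : ℂ)) (by simp)).mul_right
  have hcd : ContDiff ℝ ∞ fun ξ => ((φ ξ : ℝ) : ℂ) * 𝓕 U ξ :=
    (Complex.ofRealCLM.contDiff.comp φ.contDiff).mul ((𝓕 U).smooth ⊤)
  let g : 𝓢(EuclideanSpace ℝ (Fin d), ℂ) := hcs.toSchwartzMap hcd
  have hg : ∀ ξ, g ξ = ((φ ξ : ℝ) : ℂ) * 𝓕 U ξ := fun ξ => rfl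
  have hV : 𝓕 (𝓕⁻ g) = g := FourierTransform.fourier_fourierInv_eq g
  refine ⟨𝓕⁻ g, U - 𝓕⁻ g, fun x => by simp, fun ξ => ?_, fun ξ => ?_⟩
  · rw [hV, hg, norm_mul, Complex.norm_real, Real.norm_of_nonneg φ.nonneg]
    by_cases h : ξ ∈ Metric.ball (0 : EuclideanSpace ℝ (Fin d)) (2 * R)
    · rw [indicator_of_mem h]
      exact mul_le_of_le_one_left (norm_nonneg _) φ.le_one
    · rw [indicator_of_notMem h, φ.zero_of_le_dist (by simpa [φ] using h), zero_mul]
  · rw [show 𝓕 (U - 𝓕⁻ g) = 𝓕 U - 𝓕 (𝓕⁻ g) from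
      map_sub (FourierTransform.fourierCLM ℂ 𝓢(EuclideanSpace ℝ (Fin d), ℂ)) U (𝓕⁻ g),
      hV, sub_apply, hg]
    by_cases h : ξ ∈ Metric.ball (0 : EuclideanSpace ℝ (Fin d)) R
    · rw [φ.one_of_mem_closedBall (Metric.ball_subset_closedBall h)]
      simp [h]
    · rw [indicator_of_mem (show ξ ∈ (Metric.ball (0 : EuclideanSpace ℝ (Fin d)) R)ᶜ from h),
        show 𝓕 U ξ - ((φ ξ : ℝ) : ℂ) * 𝓕 U ξ = ((1 - φ ξ : ℝ) : ℂ) * 𝓕 U ξ by push_cast; ring,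
        norm_mul, Complex.norm_real, Real.norm_of_nonneg (by linarith [φ.le_one (x := ξ)])]
      exact mul_le_of_le_one_left (norm_nonneg _) (by linarith [φ.nonneg (x := ξ)])

theorem SchwartzMap.norm_apply_le_integral_fourier {d : ℕ}
    (U : 𝓢(EuclideanSpace ℝ (Fin d), ℂ)) (x : EuclideanSpace ℝ (Fin d)) :
    ‖U x‖ ≤ ∫ ξ, ‖𝓕 U ξ‖ := by
  have h : 𝓕⁻ (𝓕 U) x = U x := by rw [FourierTransform.fourierInv_fourier_eq U]
  rw [← h, SchwartzMap.fourierInv_coe, Real.fourierInv_eq]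
  refine (norm_integral_le_integral_norm _).trans (le_of_eq ?_)
  simp_rw [Circle.norm_smul]

/-- The Sobolev inequality of order `t` in weak form. At each level `l` the function is cut at the
frequency for which the low-frequency part stays below `l / 2`; Chebyshev's inequality then
applies to the high-frequency part. -/
theorem weak_sobolev {d : ℕ} (hd : 1 ≤ d) {t : ℝ} (ht : 0 < t) (htd : 2 * t < d) :
    ∃ C : ℝ, 0 < C ∧ ∀ (U : 𝓢(EuclideanSpace ℝ (Fin d), ℂ)) (B : ℝ), 0 < B →
      ∫ ξ, ‖ξ‖ ^ (2 * t) * ‖𝓕 U ξ‖ ^ 2 ≤ B → ∀ l : ℝ, 0 < l →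
        volume {x | l < ‖U x‖} ≤ ENNReal.ofReal (C * (B / l ^ 2) ^ (d / (d - 2 * t))) := by
  obtain ⟨V, hV0, hV⟩ := exists_setIntegral_ball_norm_rpow_le hd htd
  have : Nonempty (Fin d) := ⟨⟨0, hd⟩⟩
  have hdt : 0 < (d : ℝ) - 2 * t := by linarith
  refine ⟨4 * 2 ^ (2 * t) * (4 * V) ^ (2 * t / (d - 2 * t)), by positivity, ?_⟩
  intro U B hB hUB l hl
  -- the cut-off frequency `ρ / 2` makes the low-frequency part at most `l / 2`
  obtain ⟨ρ, hρ0, hρ⟩ : ∃ ρ : ℝ, 0 < ρ ∧ ρ = (l ^ 2 / (4 * B * V)) ^ (1 / (d - 2 * t)) :=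
    ⟨_, by positivity, rfl⟩
  have hρV : V * ρ ^ (d - 2 * t) = l ^ 2 / (4 * B) := by
    rw [hρ, ← rpow_mul (by positivity), one_div_mul_cancel hdt.ne', rpow_one]
    field_simp
  obtain ⟨Y, W, hYW, hY, hW⟩ := exists_frequency_splitting U (half_pos hρ0)
  rw [show 2 * (ρ / 2) = ρ by ring] at hY
  have hB1 := (𝓕 U).integrable_rpow_mul_sq (r := 2 * t) (by linarith)
  have hae : ∀ᵐ ξ : EuclideanSpace ℝ (Fin d), ξ ≠ 0 :=
    compl_mem_ae_iff.2 (measure_singleton (0 : EuclideanSpace ℝ (Fin d)))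
  have hlow : ∀ x, ‖Y x‖ ≤ l / 2 := fun x => by
    obtain ⟨hi, hle⟩ := hV ρ hρ0
    refine (Y.norm_apply_le_integral_fourier x).trans ?_
    -- Young's inequality, with the weight for which both terms are at most `l / 4`
    have hmono : ∫ ξ, ‖𝓕 Y ξ‖ ≤ ∫ ξ, (B / l *
        (Metric.ball (0 : EuclideanSpace ℝ (Fin d)) ρ).indicator (fun ξ => ‖ξ‖ ^ (-(2 * t))) ξ +
        l / (4 * B) * (‖ξ‖ ^ (2 * t) * ‖𝓕 U ξ‖ ^ 2)) := by
      refine integral_mono_ae (𝓕 Y).integrable.norm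
        (((hi.integrable_indicator measurableSet_ball).const_mul _).add (hB1.const_mul _)) ?_
      filter_upwards [hae] with ξ hξ
      refine (hY ξ).trans ?_
      have hx : 0 < ‖ξ‖ := norm_pos_iff.2 hξ
      by_cases h : ξ ∈ Metric.ball (0 : EuclideanSpace ℝ (Fin d)) ρ
      · simp only [indicator_of_mem h]
        rw [rpow_neg hx.le]
        have hA : 0 < ‖ξ‖ ^ (2 * t) := by positivity
        generalize ‖ξ‖ ^ (2 * t) = A at *
        generalize ‖𝓕 U ξ‖ = F
        have : B / l * A⁻¹ + l / (4 * B) * (A * F ^ 2) - F =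
            (2 * B - l * A * F) ^ 2 / (4 * B * l * A) := by field_simp; ring
        have : 0 ≤ (2 * B - l * A * F) ^ 2 / (4 * B * l * A) := by positivity
        linarith
      · simp only [indicator_of_notMem h]
        positivity
    refine hmono.trans ?_
    rw [integral_add ((hi.integrable_indicator measurableSet_ball).const_mul _)
      (hB1.const_mul _), integral_const_mul, integral_const_mul,
      integral_indicator measurableSet_ball]
    rw [hρV] at hle
    calc _ ≤ B / l * (l ^ 2 / (4 * B)) + l / (4 * B) * B := by gcongr
      _ = l / 2 := by field_simp; ring
  have hhigh : ∫ x, ‖W x‖ ^ 2 ≤ (ρ / 2) ^ (-(2 * t)) * B := by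
    rw [← W.integral_norm_sq_fourier]
    calc _ ≤ ∫ ξ, (ρ / 2) ^ (-(2 * t)) * (‖ξ‖ ^ (2 * t) * ‖𝓕 U ξ‖ ^ 2) := by
          refine integral_mono ?_ (hB1.const_mul _) fun ξ => ?_
          · have h := (𝓕 W).integrable_rpow_mul_sq (r := 0) le_rfl
            simp only [rpow_zero, one_mul] at h
            exact h
          · have h1 := hW ξ
            by_cases h : ξ ∈ Metric.ball (0 : EuclideanSpace ℝ (Fin d)) (ρ / 2)
            · rw [indicator_of_notMem (by simpa using h)] at h1
              have h2 : ‖𝓕 W ξ‖ = 0 := le_antisymm h1 (norm_nonneg _)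
              rw [h2, zero_pow two_ne_zero]
              positivity
            · rw [indicator_of_mem (by simpa using h)] at h1
              have h2 : ρ / 2 ≤ ‖ξ‖ := by simpa using h
              have h3 : 1 ≤ (ρ / 2) ^ (-(2 * t)) * ‖ξ‖ ^ (2 * t) := by
                rw [rpow_neg (by positivity), inv_mul_eq_div, one_le_div (by positivity)]
                exact rpow_le_rpow (by positivity) h2 (by linarith)
              simp only [← mul_assoc]
              refine le_trans (pow_le_pow_left₀ (norm_nonneg _) h1 2)
                (le_mul_of_one_le_left (by positivity) h3)
      _ = (ρ / 2) ^ (-(2 * t)) * ∫ ξ, ‖ξ‖ ^ (2 * t) * ‖𝓕 U ξ‖ ^ 2 := integral_const_mul _ _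
      _ ≤ _ := by gcongr
  have hsub : {x | l < ‖U x‖} ⊆ {x | ENNReal.ofReal (l ^ 2 / 4) ≤ ENNReal.ofReal (‖W x‖ ^ 2)} := by
    intro x (hx : l < ‖U x‖)
    refine ENNReal.ofReal_le_ofReal ?_
    have h1 := norm_add_le (Y x) (W x)
    rw [← hYW] at h1
    have h2 := hlow x
    have h3 : l / 2 ≤ ‖W x‖ := by linarith
    calc l ^ 2 / 4 = (l / 2) ^ 2 := by ring
      _ ≤ _ := by gcongr
  have hWi : Integrable fun x => ‖W x‖ ^ 2 := by
    have h := W.integrable_rpow_mul_sq (r := 0) le_rfl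
    simp only [rpow_zero, one_mul] at h
    exact h
  have hcW := W.continuous
  calc volume {x | l < ‖U x‖} ≤ _ := measure_mono hsub
    _ ≤ (∫⁻ x, ENNReal.ofReal (‖W x‖ ^ 2)) / ENNReal.ofReal (l ^ 2 / 4) :=
        meas_ge_le_lintegral_div (by fun_prop)
          (ENNReal.ofReal_pos.2 (by positivity)).ne' ENNReal.ofReal_ne_top
    _ = ENNReal.ofReal ((∫ x, ‖W x‖ ^ 2) / (l ^ 2 / 4)) := by
        rw [← ofReal_integral_eq_lintegral_ofReal hWi
          (Filter.Eventually.of_forall fun x => by positivity),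
          ← ENNReal.ofReal_div_of_pos (by positivity)]
    _ ≤ _ := by
        refine ENNReal.ofReal_le_ofReal ?_
        calc _ ≤ ((ρ / 2) ^ (-(2 * t)) * B) / (l ^ 2 / 4) := by gcongr
          _ = 4 * (B / l ^ 2) * (ρ / 2) ^ (-(2 * t)) := by field_simp
          _ = _ := by
            have e1 : l ^ 2 / (4 * B * V) = (B / l ^ 2)⁻¹ * (4 * V)⁻¹ := by field_simp
            have hb : 0 < B / l ^ 2 := by positivity
            have e2 : (d : ℝ) / (d - 2 * t) = 1 + 2 * t / (d - 2 * t) := by field_simp; ring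
            rw [e2, rpow_add hb, rpow_one, hρ, e1, div_eq_mul_inv _ (2 : ℝ),
              mul_rpow (by positivity) (by positivity), ← rpow_mul (by positivity),
              mul_rpow (by positivity) (by positivity), inv_rpow (by positivity),
              inv_rpow (by positivity), inv_rpow (by positivity), ← rpow_neg (by positivity),
              ← rpow_neg (by positivity), ← rpow_neg (by positivity), neg_neg,
              show -(1 / ((d : ℝ) - 2 * t) * -(2 * t)) = 2 * t / (d - 2 * t) by ring]
            ring

/-! ### The Sobolev inequality on sets of finite measure -/

/-- On a set of finite measure, weak `L^p` is contained in `L^q` for `q < p`. -/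
theorem lintegral_rpow_le_of_weak_type {α : Type*} [MeasurableSpace α] {μ : Measure α}
    {f : α → ℝ} (hf : Measurable f) (hf0 : ∀ x, 0 ≤ f x) {m W p q : ℝ} (hm : 0 < m) (hW : 0 < W)
    (hq : 0 < q) (hqp : q < p) (hsupp : μ {x | 0 < f x} ≤ ENNReal.ofReal m)
    (hweak : ∀ l, 0 < l → μ {x | l < f x} ≤ ENNReal.ofReal (W * l ^ (-p))) :
    ∫⁻ x, ENNReal.ofReal (f x ^ q) ∂μ ≤
      ENNReal.ofReal (m * (W / m) ^ (q / p) * (1 + q / (p - q))) := by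
  have hp : 0 < p := hq.trans hqp
  have hpq : 0 < p - q := by linarith
  -- the level at which the bounds `m` and `W L^(-p)` on the distribution function agree
  obtain ⟨L, hL, hLe⟩ : ∃ L : ℝ, 0 < L ∧ L = (W / m) ^ (1 / p) := ⟨_, by positivity, rfl⟩
  have hLq : (W / m) ^ (q / p) = L ^ q := by
    rw [hLe, ← rpow_mul (by positivity)]; congr 1; ring
  have hLp : W = m * L ^ p := by
    rw [hLe, ← rpow_mul (by positivity), one_div_mul_cancel hp.ne', rpow_one]
    field_simp
  rw [lintegral_rpow_eq_lintegral_meas_lt_mul μ (Filter.Eventually.of_forall hf0)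
    hf.aemeasurable hq]
  have hsplit : Ioi (0 : ℝ) = Ioc 0 L ∪ Ioi L := (Ioc_union_Ioi_eq_Ioi hL.le).symm
  have hlow : ∫⁻ t in Ioc 0 L, μ {a | t < f a} * ENNReal.ofReal (t ^ (q - 1)) ≤
      ENNReal.ofReal (m * (L ^ q / q)) := by
    have hi : IntegrableOn (fun t : ℝ => t ^ (q - 1)) (Ioc 0 L) := by
      rw [← intervalIntegrable_iff_integrableOn_Ioc_of_le hL.le]
      exact intervalIntegral.intervalIntegrable_rpow' (by linarith)
    have hval : ∫ t in Ioc 0 L, t ^ (q - 1) = L ^ q / q := by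
      rw [← intervalIntegral.integral_of_le hL.le, integral_rpow (Or.inl (by linarith))]
      simp [zero_rpow hq.ne']
    rw [← hval, ENNReal.ofReal_mul hm.le, ofReal_integral_eq_lintegral_ofReal hi,
      ← lintegral_const_mul _ (by fun_prop)]
    · refine setLIntegral_mono' measurableSet_Ioc fun t ht => ?_
      gcongr
      exact (measure_mono fun x (hx : t < f x) => ht.1.trans hx).trans hsupp
    · filter_upwards [ae_restrict_mem measurableSet_Ioc] with t ht
      exact rpow_nonneg ht.1.le _
  have hhigh : ∫⁻ t in Ioi L, μ {a | t < f a} * ENNReal.ofReal (t ^ (q - 1)) ≤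
      ENNReal.ofReal (W * (L ^ (q - p) / (p - q))) := by
    have hi : IntegrableOn (fun t : ℝ => t ^ (q - p - 1)) (Ioi L) :=
      integrableOn_Ioi_rpow_of_lt (by linarith) hL
    have hval : ∫ t in Ioi L, t ^ (q - p - 1) = L ^ (q - p) / (p - q) := by
      rw [integral_Ioi_rpow_of_lt (by linarith) hL, show q - p - 1 + 1 = -(p - q) by ring,
        div_neg, neg_div, neg_neg, neg_sub]
    rw [← hval, ENNReal.ofReal_mul hW.le, ofReal_integral_eq_lintegral_ofReal hi,
      ← lintegral_const_mul _ (by fun_prop)]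
    · refine setLIntegral_mono' measurableSet_Ioi fun t (ht : L < t) => ?_
      have ht0 : 0 < t := hL.trans ht
      calc _ ≤ ENNReal.ofReal (W * t ^ (-p)) * ENNReal.ofReal (t ^ (q - 1)) := by
            gcongr
            exact hweak t ht0
        _ = _ := by
            rw [← ENNReal.ofReal_mul (by positivity), ← ENNReal.ofReal_mul (by positivity),
              mul_assoc, ← rpow_add ht0]
            congr 3; ring
    · filter_upwards [ae_restrict_mem measurableSet_Ioi] with t (ht : L < t)
      exact rpow_nonneg (hL.trans ht).le _
  rw [hsplit, lintegral_union measurableSet_Ioi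
    (Set.disjoint_left.2 fun x h1 h2 => not_lt.2 h1.2 h2)]
  calc _ ≤ ENNReal.ofReal q * (ENNReal.ofReal (m * (L ^ q / q)) +
        ENNReal.ofReal (W * (L ^ (q - p) / (p - q)))) := by gcongr
    _ = ENNReal.ofReal (q * (m * (L ^ q / q) + W * (L ^ (q - p) / (p - q)))) := by
        rw [← ENNReal.ofReal_add (by positivity) (by positivity),
          ← ENNReal.ofReal_mul (by positivity)]
    _ ≤ _ := by
        refine ENNReal.ofReal_le_ofReal (le_of_eq ?_)
        have e : L ^ q = L ^ p * L ^ (q - p) := by rw [← rpow_add hL]; congr 1; ring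
        rw [hLq, hLp, e]
        field_simp

/-- The subcritical Sobolev inequality for functions supported in a set of finite measure. At
`q = 2` it is a Poincaré inequality. -/
theorem sobolev_finite_measure {d : ℕ} (hd : 1 ≤ d) {t q : ℝ} (ht : 0 < t) (htd : 2 * t < d)
    (hq : 0 < q) (hqt : q < 2 * d / (d - 2 * t)) :
    ∃ C : ℝ, 0 < C ∧ ∀ (U : 𝓢(EuclideanSpace ℝ (Fin d), ℂ)) (m : ℝ), 0 < m →
      volume (Function.support U) ≤ ENNReal.ofReal m →
        (eLpNorm U (ENNReal.ofReal q) volume).toReal ^ 2 ≤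
          C * m ^ (2 * (1 / q - (d - 2 * t) / (2 * d))) *
            ∫ ξ, ‖ξ‖ ^ (2 * t) * ‖𝓕 U ξ‖ ^ 2 := by
  obtain ⟨C, hC, hweak⟩ := weak_sobolev hd ht htd
  have hdt : 0 < (d : ℝ) - 2 * t := by linarith
  have hd0 : (0 : ℝ) < d := by exact_mod_cast hd
  obtain ⟨p, hp⟩ : ∃ p : ℝ, p = 2 * d / (d - 2 * t) := ⟨_, rfl⟩
  have hp0 : 0 < p := by rw [hp]; positivity
  rw [← hp] at hqt
  have hpq : 0 < p - q := by linarith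
  refine ⟨(1 + q / (p - q)) ^ (2 / q) * C ^ (2 / p), by positivity, fun U m hm hsupp => ?_⟩
  have hB0 : 0 ≤ ∫ ξ, ‖ξ‖ ^ (2 * t) * ‖𝓕 U ξ‖ ^ 2 := integral_nonneg fun ξ => by positivity
  have key : ∀ B, 0 < B → ∫ ξ, ‖ξ‖ ^ (2 * t) * ‖𝓕 U ξ‖ ^ 2 ≤ B →
      (eLpNorm U (ENNReal.ofReal q) volume).toReal ^ 2 ≤
      (1 + q / (p - q)) ^ (2 / q) * C ^ (2 / p) *
        m ^ (2 * (1 / q - (d - 2 * t) / (2 * d))) * B := by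
    intro B hB hUB
    have h := lintegral_rpow_le_of_weak_type (μ := volume) (f := fun x => ‖U x‖)
      (by have := U.continuous; fun_prop) (fun x => norm_nonneg _) hm
      (W := C * B ^ (p / 2)) (by positivity) hq hqt (by simpa [Function.support] using hsupp)
      (fun l hl => (hweak U B hB hUB l hl).trans (ENNReal.ofReal_le_ofReal (le_of_eq (by
        rw [show (d : ℝ) / (d - 2 * t) = p / 2 by rw [hp]; ring,
          div_rpow hB.le (by positivity), ← rpow_natCast, ← rpow_mul hl.le,
          rpow_neg hl.le, div_eq_mul_inv, ← mul_assoc]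
        congr 3
        push_cast
        ring))))
    have e1 : eLpNorm U (ENNReal.ofReal q) volume =
        (∫⁻ x, ENNReal.ofReal (‖U x‖ ^ q)) ^ (1 / q) := by
      rw [eLpNorm_eq_lintegral_rpow_enorm_toReal (by simpa using hq) ENNReal.ofReal_ne_top,
        ENNReal.toReal_ofReal hq.le]
      congr 1
      refine lintegral_congr fun x => ?_
      rw [← ofReal_norm, ENNReal.ofReal_rpow_of_nonneg (norm_nonneg _) hq.le]
    have h2 : eLpNorm U (ENNReal.ofReal q) volume ≤ ENNReal.ofReal
        ((m * (C * B ^ (p / 2) / m) ^ (q / p) * (1 + q / (p - q))) ^ (1 / q)) := by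
      rw [e1, ← ENNReal.ofReal_rpow_of_nonneg (by positivity) (by positivity)]
      exact ENNReal.rpow_le_rpow h (by positivity)
    have h3 := ENNReal.toReal_le_of_le_ofReal (by positivity) h2
    refine (pow_le_pow_left₀ ENNReal.toReal_nonneg h3 2).trans (le_of_eq ?_)
    have hip : ((d : ℝ) - 2 * t) / (2 * d) = 1 / p := by rw [hp, one_div_div]
    rw [hip, ← rpow_natCast, ← rpow_mul (by positivity), mul_rpow (by positivity) (by positivity),
      mul_rpow (by positivity) (by positivity), ← rpow_mul (by positivity),
      div_rpow (by positivity) (by positivity), mul_rpow (by positivity) (by positivity),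
      ← rpow_mul hB.le]
    rw [show p / 2 * (q / p * (1 / q * ((2 : ℕ) : ℝ))) = 1 by push_cast; field_simp, rpow_one,
      show q / p * (1 / q * ((2 : ℕ) : ℝ)) = 2 / p by push_cast; field_simp,
      show 1 / q * ((2 : ℕ) : ℝ) = 2 / q by push_cast; ring,
      show 2 * (1 / q - 1 / p) = 2 / q - 2 / p by ring, rpow_sub hm]
    ring
  -- the energy may vanish, while `weak_sobolev` needs a positive bound for it
  refine le_of_forall_pos_le_add fun δ hδ => ?_
  set D := (1 + q / (p - q)) ^ (2 / q) * C ^ (2 / p) *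
        m ^ (2 * (1 / q - (d - 2 * t) / (2 * d))) with hD
  have hD0 : 0 < D := by positivity
  have h := key ((∫ ξ, ‖ξ‖ ^ (2 * t) * ‖𝓕 U ξ‖ ^ 2) + δ / D) (by positivity)
    (by have : 0 < δ / D := by positivity
        linarith)
  rw [mul_add, mul_div_cancel₀ _ hD0.ne'] at h
  exact h

/-! ### Absorption of the zeroth-order term -/

theorem integral_rpow_mul_unitaryFourier_sq {d : ℕ} (r : ℝ) (u : EuclideanSpace ℝ (Fin d) → ℂ) :
    ∫ ξ, ‖ξ‖ ^ r * ‖unitaryFourier u ξ‖ ^ 2 =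
      (2 * π) ^ r * ∫ ξ, ‖ξ‖ ^ r * ‖𝓕 u ξ‖ ^ 2 := by
  have h := Measure.integral_comp_smul (volume : Measure (EuclideanSpace ℝ (Fin d)))
    (fun ξ => ‖ξ‖ ^ r * ‖𝓕 u ξ‖ ^ 2) (2 * π)⁻¹
  have h2π : 0 < 2 * π := by positivity
  have e : ∀ ξ, ‖ξ‖ ^ r * ‖unitaryFourier u ξ‖ ^ 2 = (2 * π) ^ r * ((2 * π) ^ d)⁻¹ *
      (‖(2 * π)⁻¹ • ξ‖ ^ r * ‖𝓕 u ((2 * π)⁻¹ • ξ)‖ ^ 2) := fun ξ => by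
    have e1 : ((2 * π) ^ (-((d : ℝ) / 2))) ^ 2 = ((2 * π) ^ d)⁻¹ := by
      rw [← rpow_natCast, ← rpow_mul h2π.le, ← rpow_natCast, ← rpow_neg h2π.le]
      congr 1
      push_cast
      ring
    rw [unitaryFourier_eq, norm_mul, mul_pow, Complex.norm_real,
      Real.norm_of_nonneg (by positivity), e1, norm_smul,
      Real.norm_of_nonneg (by positivity), mul_rpow (by positivity) (norm_nonneg _),
      inv_rpow h2π.le]
    field_simp
  simp only [e]
  rw [integral_const_mul, h, finrank_euclideanSpace, Fintype.card_fin, inv_pow, inv_inv,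
    abs_of_pos (by positivity), smul_eq_mul]
  field_simp

theorem eLpNorm_two_toReal_sq {d : ℕ} (U : 𝓢(EuclideanSpace ℝ (Fin d), ℂ)) :
    (eLpNorm U (ENNReal.ofReal 2) volume).toReal ^ 2 = ∫ x, ‖U x‖ ^ 2 := by
  have hi : 0 ≤ ∫ x, ‖U x‖ ^ 2 := integral_nonneg fun x => by positivity
  have h2 : ENNReal.ofReal 2 = 2 := by simp
  rw [h2, (U.memLp 2 volume).eLpNorm_eq_integral_rpow_norm (by simp) (by simp)]
  simp only [ENNReal.toReal_ofNat, rpow_two]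
  rw [ENNReal.toReal_ofReal (by positivity), ← rpow_natCast, ← rpow_mul hi]
  simp

/-- The order `2s - ε` of the remainder is taken so close to `2s` that `q` is still subcritical
for it. That `2s / ε` is an integer `n + 3` turns the powers of `‖ξ‖` in `improved_hardy` into
powers of `‖ξ‖^ε`. -/
theorem exists_subcritical_exponent {d s q : ℝ} (hs : 0 < s) (hsd : 2 * s < d) (hq : 0 < q)
    (hq' : q < 2 * d / (d - 2 * s)) :
    ∃ (n : ℕ) (ε : ℝ), 0 < ε ∧ ε * (n + 3) = 2 * s ∧ 2 * ε < d / 2 - s ∧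
      q < 2 * d / (d - (2 * s - ε)) := by
  have hds : 0 < d - 2 * s := by linarith
  rw [lt_div_iff₀ hds] at hq'
  obtain ⟨η, hη, h1, h2⟩ : ∃ η : ℝ, 0 < η ∧ η ≤ (d / 2 - s) / 2 ∧
      η ≤ (2 * d - q * (d - 2 * s)) / q :=
    ⟨min ((d / 2 - s) / 2) ((2 * d - q * (d - 2 * s)) / q),
      lt_min (by linarith) (div_pos (by linarith) hq), min_le_left _ _, min_le_right _ _⟩
  obtain ⟨n, hn⟩ := exists_nat_gt (2 * s / η)
  have hn3 : (0 : ℝ) < n + 3 := by positivity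
  have hlt : 2 * s / (n + 3) < η := by
    rw [div_lt_iff₀ hη] at hn
    rw [div_lt_iff₀ hn3]
    nlinarith
  have hε0 : 0 < 2 * s / (n + 3) := by positivity
  refine ⟨n, 2 * s / (n + 3), hε0, by field_simp, by linarith, ?_⟩
  generalize 2 * s / (n + 3) = ε at hlt hε0
  rw [le_div_iff₀ hq] at h2
  rw [lt_div_iff₀ (by linarith)]
  nlinarith

/-- On functions supported in a set of measure `m`, the zeroth-order term of `improved_hardy` is
absorbed by the remainder when `μ` is a small multiple of `m^(-ε/d)`, because `‖u‖²` is bounded by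
the Poincaré inequality and carries the higher power `μ^(n+3)`. -/
theorem exists_remainder_bound {d : ℕ} (hd : 1 ≤ d) {s ε : ℝ} {n : ℕ} (hs : 0 < s)
    (hε : 0 < ε) (hεn : ε * (n + 3) = 2 * s) (hεd : 2 * ε < d / 2 - s) :
    ∃ C : ℝ, 0 < C ∧ ∀ (U : 𝓢(EuclideanSpace ℝ (Fin d), ℂ)) (m : ℝ), 0 < m →
      volume (Function.support U) ≤ ENNReal.ofReal m →
        ∫ ξ, ‖ξ‖ ^ (2 * s - ε) * ‖𝓕 U ξ‖ ^ 2 ≤ C * m ^ (ε / d) * hardyForm s U := by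
  have hd0 : (0 : ℝ) < d := by exact_mod_cast hd
  have hn0 : (0 : ℝ) ≤ n := n.cast_nonneg
  obtain ⟨c, K, hc, hK, hmain⟩ := improved_hardy hd hs hε hεn hεd
  have ht : 0 < s - ε / 2 := by nlinarith
  have htd : 2 * (s - ε / 2) < d := by linarith
  obtain ⟨P, hP, hpoin⟩ := sobolev_finite_measure (q := 2) hd ht htd two_pos (by
    rw [lt_div_iff₀ (by linarith)]
    linarith)
  rw [show 2 * (s - ε / 2) = 2 * s - ε by ring] at hpoin
  obtain ⟨ν, hν, hν1, hνK⟩ : ∃ ν : ℝ, 0 < ν ∧ ν ≤ 1 ∧ K * P * ν ≤ c / 2 := by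
    refine ⟨min 1 (c / 2 / (K * P + 1)), lt_min one_pos (by positivity), min_le_left _ _, ?_⟩
    calc _ ≤ (K * P + 1) * (c / 2 / (K * P + 1)) := by
          gcongr
          · linarith
          · exact min_le_right _ _
      _ = c / 2 := by field_simp
  refine ⟨2 / (c * ν), by positivity, fun U m hm hsupp => ?_⟩
  have hpU := hpoin U m hm hsupp
  rw [eLpNorm_two_toReal_sq, show 2 * (1 / 2 - ((d : ℝ) - (2 * s - ε)) / (2 * d)) =
    (2 * s - ε) / d by field_simp; ring] at hpU
  have hμ0 : 0 < ν * m ^ (-(ε / d)) := by positivity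
  have hU := hmain U (ν * m ^ (-(ε / d))) hμ0
  have hform : hardyForm s U = (2 * π) ^ (2 * s) * (∫ ξ, ‖ξ‖ ^ (2 * s) * ‖𝓕 U ξ‖ ^ 2) -
      hardyConst s d * ∫ x, ‖x‖ ^ (-(2 * s)) * ‖U x‖ ^ 2 := by
    rw [hardyForm, integral_rpow_mul_unitaryFourier_sq]
    rfl
  have hB0 : 0 ≤ ∫ ξ, ‖ξ‖ ^ (2 * s - ε) * ‖𝓕 U ξ‖ ^ 2 := integral_nonneg fun ξ => by positivity
  generalize ∫ ξ, ‖ξ‖ ^ (2 * s - ε) * ‖𝓕 U ξ‖ ^ 2 = B at *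
  have hKB : K * (ν * m ^ (-(ε / d))) ^ (n + 3) * ∫ x, ‖U x‖ ^ 2 ≤
      c / 2 * (ν * m ^ (-(ε / d))) * B := by
    have e1 : (m ^ (-(ε / d))) ^ (n + 3) * m ^ ((2 * s - ε) / d) = m ^ (-(ε / d)) := by
      rw [← rpow_natCast, ← rpow_mul hm.le, ← rpow_add hm]
      congr 1
      push_cast
      field_simp
      linarith
    have e2 : ν ^ (n + 3) ≤ ν * ν := by
      rw [← pow_two]
      exact pow_le_pow_of_le_one hν.le hν1 (by omega)
    calc _ ≤ K * (ν * m ^ (-(ε / d))) ^ (n + 3) * (P * m ^ ((2 * s - ε) / d) * B) := by gcongr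
      _ = K * P * ν ^ (n + 3) * ((m ^ (-(ε / d))) ^ (n + 3) * m ^ ((2 * s - ε) / d)) * B := by
          rw [mul_pow]; ring
      _ = K * P * ν ^ (n + 3) * m ^ (-(ε / d)) * B := by rw [e1]
      _ ≤ K * P * (ν * ν) * m ^ (-(ε / d)) * B := by gcongr
      _ = K * P * ν * (ν * m ^ (-(ε / d)) * B) := by ring
      _ ≤ c / 2 * (ν * m ^ (-(ε / d)) * B) := by gcongr
      _ = _ := by ring
  have hlow : c / 2 * (ν * m ^ (-(ε / d))) * B ≤ hardyForm s U := by
    rw [hform]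
    linarith
  rw [rpow_neg hm.le] at hlow
  calc B = 2 / (c * ν) * m ^ (ε / d) * (c / 2 * (ν * (m ^ (ε / d))⁻¹) * B) := by field_simp
    _ ≤ _ := by gcongr

end

theorem theorem2p2 (d : ℕ) (s q : ℝ) (hs : 0 < s) (hs' : s < min 1 ((d : ℝ) / 2))
    (hq : 1 ≤ q) (hq' : q < 2 * (d : ℝ) / ((d : ℝ) - 2 * s)) :
    ∃ C : ℝ, 0 < C ∧
      ∀ Ω : Set (EuclideanSpace ℝ (Fin d)), IsOpen Ω → volume Ω ≠ ⊤ →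
        ∀ u : EuclideanSpace ℝ (Fin d) → ℂ, IsTestFunctionOn Ω u →
          (eLpNorm u (ENNReal.ofReal q) volume).toReal ^ 2 ≤
            C * (volume Ω).toReal ^ (2 * (1 / q - 1 / (2 * (d : ℝ) / ((d : ℝ) - 2 * s)))) *
              hardyForm s u := by
  have hsd : s < (d : ℝ) / 2 := hs'.trans_le (min_le_right _ _)
  have hd0 : (0 : ℝ) < d := by linarith
  have hd : 1 ≤ d := by exact_mod_cast hd0
  have hq0 : 0 < q := by linarith
  obtain ⟨n, ε, hε, hεn, hεd, hqε⟩ := exists_subcritical_exponent hs (by linarith) hq0 hq'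
  have ht : 0 < s - ε / 2 := by nlinarith [(n.cast_nonneg : (0 : ℝ) ≤ n)]
  obtain ⟨C₁, hC₁, hrem⟩ := exists_remainder_bound hd hs hε hεn hεd
  obtain ⟨C₂, hC₂, hsob⟩ := sobolev_finite_measure (q := q) hd ht (by linarith) hq0
    (by rwa [show 2 * (s - ε / 2) = 2 * s - ε by ring])
  rw [show 2 * (s - ε / 2) = 2 * s - ε by ring] at hsob
  refine ⟨C₂ * C₁, by positivity, fun Ω hΩ hfin u hu => ?_⟩
  -- an open null set is empty
  rcases eq_or_ne (volume Ω) 0 with h0 | h0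
  · have hu0 : u = 0 := by
      rw [hΩ.measure_eq_zero_iff volume] at h0
      have h := hu.tsupport_subset
      rw [h0, Set.subset_empty_iff, tsupport_eq_empty_iff] at h
      exact h
    simp [hu0, hardyForm, unitaryFourier]
  · set m := (volume Ω).toReal with hmΩ
    have hm : 0 < m := ENNReal.toReal_pos h0 hfin
    let U : SchwartzMap (EuclideanSpace ℝ (Fin d)) ℂ :=
      hu.hasCompactSupport.toSchwartzMap hu.contDiff
    have hUu : ⇑U = u := rfl
    have hsupp : volume (Function.support U) ≤ ENNReal.ofReal m := by
      rw [hmΩ, ENNReal.ofReal_toReal hfin, hUu]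
      exact measure_mono ((subset_tsupport u).trans hu.tsupport_subset)
    have h1 := hsob U m hm hsupp
    have h2 := hrem U m hm hsupp
    rw [hUu] at h1 h2
    calc _ ≤ _ := h1
      _ ≤ C₂ * m ^ (2 * (1 / q - (d - (2 * s - ε)) / (2 * d))) *
          (C₁ * m ^ (ε / d) * hardyForm s u) := by
          gcongr
      _ = C₂ * C₁ * (m ^ (2 * (1 / q - (d - (2 * s - ε)) / (2 * d))) * m ^ (ε / d)) *
          hardyForm s u := by ring
      _ = _ := by
          rw [← Real.rpow_add hm]
          congr 3
          have : (d : ℝ) - 2 * s ≠ 0 := by linarith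
          field_simp
          ring
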